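/- **Setting.** Let $V$ be a finite set and let $W=(W_{ij})_{i,j\in V}$ be edge weights with $W_{ij}=W_{ji}\ge 0$ and $W_{ii}=0$ (where $W_{ij}=0$ means that there is no edge between $i$ and $j$; connectedness is not needed). For $\beta\in\mathbb{R}^V$ let $H_\beta$ be the symmetric $V\times V$ matrix with $H_\beta(i,i)=2\beta_i$ and $H_\beta(i,j)=-W_{ij}$ for $i\neq j$. For $\eta\in[0,\infty)^V$, the $H^{2|2}$-model on $(V,W)$ with boundary condition $\eta$ is the random Schrödinger operator $H=H_\beta$, where the random potential $\beta$ has the law $$d\nu^{W,\eta}(\beta)=\Big(\sqrt{\tfrac{2}{\pi}}\Big)^{|V|}\mathbf 1_{\{H_\beta>0\}}\,e^{-\frac12\left(\langle 1,H_\beta 1\rangle+\langle\eta,H_\beta^{-1}\eta\rangle-2\langle 1,\eta\rangle\right)}\frac{1}{\sqrt{\det H_\beta}}\prod_{i\in V}d\beta_i ,$$ $H_\beta>0$ meaning that $H_\beta$ is positive definite. Its Green matrix is $G=H^{-1}$. The case $\eta=0$ is the model without boundary condition. A subset $U\subset V$ is *indistinguishable from outside* if $W_{ki}=W_{kj}$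 for all $i,j\in U$ and $k\notin U$, and $\eta_i=\eta_j$ for all $i,j\in U$. **Theorem.** Let $\beta$ have law $\nu^{W,\eta}$, let $G=H^{-1}$, and let $U\subset V$ be non-empty and indistinguishable from outside. Put $V'=(V\setminus U)\cup\{u\}$, where $u$ is a new vertex, and define the $V'\times V'$ matrix $G'$ by $$G'(k,\ell)=G(k,\ell)\ \ (k,\ell\notin U),\qquad G'(k,u)=\frac1{|U|}\sum_{i\in U}G(k,i),\quad G'(u,k)=\frac1{|U|}\sum_{i\in U}G(i,k)\ \ (k\notin U),\qquad G'(u,u)=\frac1{|U|^2}\sum_{i,j\in U}G(i,j).$$ Define the reduced weights by $W'_{k\ell}=W_{k\ell}$ for $k,\ell\ne u$, $W'_{ku}=W'_{uk}=\sum_{i\in U}W_{ki}$ for $k\neq u$, and $W'_{uu}=0$, and the reduced boundary condition by $\eta'_k=\eta_k$ for $k\ne u$ and $\eta'_u=\sum_{i\in U}\eta_i$. Then: 1. $G'$ has the same law as the Green matrix of the $H^{2|2}$-model on $(V',W')$ with boundary condition $\eta'$. 2. Let $H_{U,U}$ be the submatrix of $H$ on $U\times U$, and define $\beta'\in\mathbb{R}^{V'}$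 by $\beta'_k=\beta_k$ for $k\neq u$ and $$\frac1{2\beta'_u}=\frac1{|U|^2}\sum_{i,j\in U}(H_{U,U})^{-1}(i,j).$$ Almost surely, $H$, $H_{U,U}$ and $G'$ are positive definite (in particular invertible), $\beta'_u$ is well defined and positive, and $(G')^{-1}=H'_{\beta'}$, the matrix with diagonal entries $2\beta'_k$ and off-diagonal entries $-W'_{k\ell}$. 3. The random vector $\beta'$ has law $\nu^{W',\eta'}$, that is, $(G')^{-1}=H'_{\beta'}$ is the random Schrödinger operator of the $H^{2|2}$-model on $(V',W')$ with boundary condition $\eta'$. -/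

import Mathlib

open MeasureTheory ProbabilityTheory Matrix

namespace HTwoTwo

noncomputable section

/-- A finite (simple, unoriented) weighted graph on the vertex set `V`, given by its symmetric
nonnegative edge weights; `{i, j}` is an edge exactly when `weight i j > 0`. -/
structure WeightedGraph (V : Type*) where
  weight : V → V → ℝ
  symm : ∀ i j, weight i j = weight j i
  nonneg : ∀ i j, 0 ≤ weight i j
  loopless : ∀ i, weight i i = 0

/-- The Schrödinger matrix `H_β`: diagonal entries `2 β i`, off-diagonal entries `-W i j`
(the weights vanish on the diagonal). -/
def schrodinger {V : Type*} [DecidableEq V] (𝒢 : WeightedGraph V) (β : V → ℝ) : Matrix V V ℝ :=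
  Matrix.diagonal (fun i => 2 * β i) - Matrix.of 𝒢.weight

/-- The Green matrix `G = H_β⁻¹`. -/
def green {V : Type*} [Fintype V] [DecidableEq V] (𝒢 : WeightedGraph V) (β : V → ℝ) :
    Matrix V V ℝ :=
  (schrodinger 𝒢 β)⁻¹

open Classical in
/-- The density of the random potential of the `H^{2|2}`-model with boundary condition `η`
(and initial local time `1`) with respect to Lebesgue measure. -/
def density {V : Type*} [Fintype V] [DecidableEq V] (𝒢 : WeightedGraph V) (η : V → ℝ)
    (β : V → ℝ) : ℝ :=
  if (schrodinger 𝒢 β).PosDef then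
    Real.sqrt (2 / Real.pi) ^ Fintype.card V *
      Real.exp (-(1 / 2) * ((1 : V → ℝ) ⬝ᵥ (schrodinger 𝒢 β *ᵥ (1 : V → ℝ))
        + η ⬝ᵥ ((schrodinger 𝒢 β)⁻¹ *ᵥ η) - 2 * ((1 : V → ℝ) ⬝ᵥ η))) /
      Real.sqrt (schrodinger 𝒢 β).det
  else 0

/-- The law `ν^{W,1,η}` of the random potential `β` of the `H^{2|2}`-model on `𝒢` with
boundary condition `η`. -/
def potentialLaw {V : Type*} [Fintype V] [DecidableEq V] (𝒢 : WeightedGraph V) (η : V → ℝ) :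
    Measure (V → ℝ) :=
  (volume : Measure (V → ℝ)).withDensity (fun β => ENNReal.ofReal (density 𝒢 η β))

/-- The law of the random Green matrix of the `H^{2|2}`-model on `𝒢` with boundary
condition `η`, as a measure on the space `V → V → ℝ` of arrays of matrix entries. -/
def greenLaw {V : Type*} [Fintype V] [DecidableEq V] (𝒢 : WeightedGraph V) (η : V → ℝ) :
    Measure (V → V → ℝ) :=
  (potentialLaw 𝒢 η).map (fun β i j => green 𝒢 β i j)

/-- `U` is indistinguishable from outside, with respect to the weights and to the boundary
condition `η`. -/
def Indistinguishable {V : Type*} (𝒢 : WeightedGraph V) (η : V → ℝ) (U : Finset V) : Prop :=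
  (∀ i ∈ U, ∀ j ∈ U, ∀ k ∉ U, 𝒢.weight k i = 𝒢.weight k j) ∧ ∀ i ∈ U, ∀ j ∈ U, η i = η j

/-- The reduced vertex set `(V ∖ U) ∪ {u}`; the merged vertex `u` is `none`. -/
abbrev Reduced {V : Type*} (U : Finset V) : Type _ := Option {k : V // k ∉ U}

/-- The weights of the reduced graph. -/
def reducedWeight {V : Type*} (𝒢 : WeightedGraph V) (U : Finset V) :
    Reduced U → Reduced U → ℝ
  | some k, some l => 𝒢.weight k l
  | some k, none => ∑ i ∈ U, 𝒢.weight k i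
  | none, some l => ∑ i ∈ U, 𝒢.weight l i
  | none, none => 0

/-- The reduced weighted graph, in which `U` is merged into one vertex. -/
def reducedGraph {V : Type*} (𝒢 : WeightedGraph V) (U : Finset V) :
    WeightedGraph (Reduced U) where
  weight := reducedWeight 𝒢 U
  symm := by
    rintro (_ | k) (_ | l)
    · rfl
    · rfl
    · rfl
    · exact 𝒢.symm k l
  nonneg := by
    rintro (_ | k) (_ | l)
    · exact le_refl 0
    · exact Finset.sum_nonneg fun i _ => 𝒢.nonneg l i
    · exact Finset.sum_nonneg fun i _ => 𝒢.nonneg k i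
    · exact 𝒢.nonneg k l
  loopless := by
    rintro (_ | k)
    · rfl
    · exact 𝒢.loopless k

/-- The reduced boundary condition. -/
def reducedBoundary {V : Type*} (η : V → ℝ) (U : Finset V) : Reduced U → ℝ
  | some k => η k
  | none => ∑ i ∈ U, η i

/-- The coarse-grained matrix `G'`, obtained from `G` by averaging over `U`. -/
def coarseGrain {V : Type*} (U : Finset V) (G : Matrix V V ℝ) :
    Matrix (Reduced U) (Reduced U) ℝ :=
  Matrix.of fun k l =>
    match k, l with
    | some k, some l => G k l
    | some k, none => (1 / (U.card : ℝ)) * ∑ i ∈ U, G k i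
    | none, some l => (1 / (U.card : ℝ)) * ∑ i ∈ U, G i l
    | none, none => (1 / (U.card : ℝ) ^ 2) * ∑ i ∈ U, ∑ j ∈ U, G i j

/-- The block `H_{U,U}` of the Schrödinger matrix. -/
def block {V : Type*} [DecidableEq V] (𝒢 : WeightedGraph V) (U : Finset V) (β : V → ℝ) :
    Matrix {i : V // i ∈ U} {i : V // i ∈ U} ℝ :=
  (schrodinger 𝒢 β).submatrix (fun i => (i : V)) (fun i => (i : V))

/-- `|U|⁻² ∑_{i,j ∈ U} (H_{U,U})⁻¹(i,j)`. -/
def blockAverage {V : Type*} [DecidableEq V] (𝒢 : WeightedGraph V) (U : Finset V)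
    (β : V → ℝ) : ℝ :=
  (1 / (U.card : ℝ) ^ 2) * ∑ i, ∑ j, (block 𝒢 U β)⁻¹ i j

/-- The coarse-grained potential `β'`: it equals `β` off `U`, and
`1 / (2 β'_u) = |U|⁻² ∑_{i,j ∈ U} (H_{U,U})⁻¹(i,j)`. -/
def coarsePotential {V : Type*} [DecidableEq V] (𝒢 : WeightedGraph V) (U : Finset V)
    (β : V → ℝ) : Reduced U → ℝ
  | some k => β k
  | none => 1 / (2 * blockAverage 𝒢 U β)

end

end HTwoTwo

/-!
The model is analysed by block Gaussian elimination. Split the vertices into two parts, and let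
`D` be the block of `H` on the second part, with potential `y`. The Schur complement formulas for
positivity, determinant and inverse factor the density at `(x, y)` as the density at `y` of the
model without boundary condition on the second part, times a factor in `x` that depends on `y`
only through `D⁻¹` applied to the connecting weights and to the boundary values (`density_join`).

If the second part is an indistinguishable set `U`, these weights and boundary values are constant
along `U`, so the factor depends on `y` only through `a = |U|⁻² ⟨1, D⁻¹ 1⟩`, and as a function of
`(x, a)` it is the same factor as for the reduced graph, where the second part is the single vertex
`u` and `a = 1 / (2 β_u)` (`density_join_of_const`). By Fubini, the law of `β'` is the asserted one
as soon as `a` has the same law for every graph without boundary condition.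

This universality (`map_greenMean_eq`) follows from the normalization of the density for all
nonnegative boundary conditions (`lintegral_density`): with boundary condition constant equal to
`√k / |U|`, it says that `exp (-a / 2)` has `k`-th moment `exp (-√k)`, and a bounded variable is
determined by its moments (`ext_of_moments_eq`). The normalization is proved by induction on the
number of vertices: integrating out one vertex `v` is the inverse Gaussian integral
`∫ t^{-1/2} exp (-(t + q² / t) / 2) dt = √(2π) exp (-q)` over `t > 0`, and it leaves the model on
the other vertices with `W_{v,·}` added to the boundary condition. Here `q ≥ 0` because the inverse
of a symmetric M-matrix has nonnegative entries.

The identity for Green matrices is linear algebra. The averaged Green matrix is `G' = P G Pᵀ` with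
`P` the averaging matrix, and there is an explicit right inverse `X` of `P` with `H X = Pᵀ H'`
(`schrodinger_mul_averagingSection`), whence `G' H' = P G Pᵀ H' = P X = 1`. The law of `G'` is then
read off from the law of `β'`.
-/

namespace HTwoTwo

/-! ### Block matrices and M-matrices -/

section Blocks

variable {m n : Type*} [Fintype m] [DecidableEq m] [Fintype n] [DecidableEq n]

theorem posDef_fromBlocks_iff (A : Matrix m m ℝ) (B : Matrix m n ℝ) (D : Matrix n n ℝ) :
    (fromBlocks A (-B) (-Bᵀ) D).PosDef ↔ D.PosDef ∧ (A - B * D⁻¹ * Bᵀ).PosDef := by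
  have key : ∀ hD : D.PosDef,
      ((fromBlocks A (-B) (-Bᵀ) D).PosDef ↔ (A - B * D⁻¹ * Bᵀ).PosDef) := by
    intro hD
    have : Invertible D := hD.isUnit.invertible
    have h1 := PosDef.fromBlocks₂₂ A (-B) hD
    have h2 := isUnit_fromBlocks_iff_of_invertible₂₂ (A := A) (B := -B) (C := -Bᵀ) (D := D)
    simp only [conjTranspose_eq_transpose_of_trivial, transpose_neg, Matrix.neg_mul,
      Matrix.mul_neg, neg_neg, invOf_eq_nonsing_inv] at h1 h2
    exact ⟨fun h => (h1.1 h.posSemidef).posDef_iff_isUnit.2 (h2.1 h.isUnit),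
      fun h => (h1.2 h.posSemidef).posDef_iff_isUnit.2 (h2.2 h.isUnit)⟩
  constructor
  · intro h
    have hD : D.PosDef := by
      have := h.submatrix (e := (Sum.inr : n → m ⊕ n)) Sum.inr_injective
      exact this
    exact ⟨hD, (key hD).1 h⟩
  · rintro ⟨hD, hS⟩
    exact (key hD).2 hS

theorem det_fromBlocks_schur (A : Matrix m m ℝ) (B : Matrix m n ℝ) {D : Matrix n n ℝ}
    (hD : D.PosDef) :
    (fromBlocks A (-B) (-Bᵀ) D).det = D.det * (A - B * D⁻¹ * Bᵀ).det := by
  have : Invertible D := hD.isUnit.invertible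
  rw [det_fromBlocks₂₂]
  simp

/-- The quadratic form of the inverse of a block matrix, in terms of the Schur complement. -/
theorem dotProduct_inv_fromBlocks (A : Matrix m m ℝ) (B : Matrix m n ℝ) {D : Matrix n n ℝ}
    (hD : D.PosDef) (hS : (A - B * D⁻¹ * Bᵀ).PosDef) (u : m → ℝ) (v : n → ℝ) :
    Sum.elim u v ⬝ᵥ ((fromBlocks A (-B) (-Bᵀ) D)⁻¹ *ᵥ Sum.elim u v) =
      v ⬝ᵥ (D⁻¹ *ᵥ v) + (u + B *ᵥ (D⁻¹ *ᵥ v)) ⬝ᵥ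
        ((A - B * D⁻¹ * Bᵀ)⁻¹ *ᵥ (u + B *ᵥ (D⁻¹ *ᵥ v))) := by
  set z := u + B *ᵥ (D⁻¹ *ᵥ v) with hz
  set s := (A - B * D⁻¹ * Bᵀ)⁻¹ *ᵥ z with hs
  have hM := ((posDef_fromBlocks_iff A B D).2 ⟨hD, hS⟩).isUnit
  have hSs : (A - B * D⁻¹ * Bᵀ) *ᵥ s = z := by
    rw [hs, mulVec_mulVec, mul_nonsing_inv _ ((isUnit_iff_isUnit_det _).1 hS.isUnit), one_mulVec]
  have hDt : (D⁻¹)ᵀ = D⁻¹ := by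
    simpa using hD.inv.isHermitian.eq
  -- the solution of the block system, by elimination of the second block
  have hsol : fromBlocks A (-B) (-Bᵀ) D *ᵥ Sum.elim s (D⁻¹ *ᵥ (v + Bᵀ *ᵥ s)) = Sum.elim u v := by
    rw [fromBlocks_mulVec]
    congr 1
    · simp only [Sum.elim_comp_inl, Sum.elim_comp_inr]
      rw [sub_mulVec, ← mulVec_mulVec, ← mulVec_mulVec] at hSs
      rw [mulVec_add, neg_mulVec, mulVec_add, ← sub_eq_add_neg, ← sub_sub, sub_right_comm, hSs, hz]
      simp
    · simp only [Sum.elim_comp_inl, Sum.elim_comp_inr]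
      rw [mulVec_mulVec _ D, mul_nonsing_inv _ ((isUnit_iff_isUnit_det _).1 hD.isUnit), one_mulVec,
        neg_mulVec]
      abel
  have hinv : (fromBlocks A (-B) (-Bᵀ) D)⁻¹ *ᵥ Sum.elim u v =
      Sum.elim s (D⁻¹ *ᵥ (v + Bᵀ *ᵥ s)) := by
    rw [← hsol, mulVec_mulVec, nonsing_inv_mul _ ((isUnit_iff_isUnit_det _).1 hM), one_mulVec]
  have hsymm : v ⬝ᵥ (D⁻¹ *ᵥ (Bᵀ *ᵥ s)) = (B *ᵥ (D⁻¹ *ᵥ v)) ⬝ᵥ s := by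
    rw [dotProduct_mulVec, dotProduct_mulVec, vecMul_transpose, ← mulVec_transpose, hDt]
  rw [hinv, sumElim_dotProduct_sumElim, mulVec_add, dotProduct_add, hsymm, hz, add_dotProduct]
  ring

/-- The inverse of a positive definite matrix with nonpositive off-diagonal entries (a symmetric
M-matrix) preserves nonnegativity: testing `M x = b` against the negative part of `x` shows that
this negative part vanishes. -/
theorem inv_mulVec_nonneg {M : Matrix n n ℝ} (hM : M.PosDef) (hoff : ∀ i j, i ≠ j → M i j ≤ 0)
    {b : n → ℝ} (hb : ∀ i, 0 ≤ b i) (i : n) : 0 ≤ (M⁻¹ *ᵥ b) i := by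
  set x := M⁻¹ *ᵥ b with hx
  have hMx : M *ᵥ x = b := by
    rw [hx, mulVec_mulVec, mul_nonsing_inv _ ((isUnit_iff_isUnit_det _).1 hM.isUnit), one_mulVec]
  set y : n → ℝ := fun i => max (-x i) 0 with hy
  set z : n → ℝ := fun i => max (x i) 0 with hz
  have hxyz : x = z - y := by
    ext i
    simp only [hy, hz, Pi.sub_apply]
    rcases le_total (x i) 0 with h | h
    · rw [max_eq_right h, max_eq_left (by linarith)]; ring
    · rw [max_eq_left h, max_eq_right (by linarith)]; ring
  have h1 : 0 ≤ y ⬝ᵥ b :=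
    Finset.sum_nonneg fun i _ => mul_nonneg (le_max_right _ _) (hb i)
  have h2 : y ⬝ᵥ (M *ᵥ z) ≤ 0 := by
    simp only [dotProduct, mulVec, Finset.mul_sum]
    refine Finset.sum_nonpos fun i _ => Finset.sum_nonpos fun j _ => ?_
    by_cases hij : i = j
    · subst hij
      have : y i * z i = 0 := by
        simp only [hy, hz]
        rcases le_total (x i) 0 with h | h
        · rw [max_eq_right h, mul_zero]
        · rw [max_eq_right (by linarith : -x i ≤ 0), zero_mul]
      rw [mul_left_comm, this, mul_zero]
    · have := mul_nonneg (le_max_right (-x i) 0 : 0 ≤ y i) (le_max_right (x j) 0 : 0 ≤ z j)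
      have := hoff i j hij
      nlinarith
  have h3 : y = 0 := by
    by_contra hne
    have hpos := hM.dotProduct_mulVec_pos hne
    rw [← hMx, hxyz, mulVec_sub, dotProduct_sub] at h1
    simp only [star_trivial] at hpos
    linarith
  have := congrFun h3 i
  simp only [hy, Pi.zero_apply] at this
  have := le_max_left (-x i) 0
  linarith

end Blocks

/-! ### The inverse Gaussian integral -/

theorem lintegral_exp_neg_sq_div_two :
    ∫⁻ y : ℝ, ENNReal.ofReal (Real.exp (-y ^ 2 / 2)) =
      ENNReal.ofReal (Real.sqrt (2 * Real.pi)) := by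
  have h := integral_gaussian (1 / 2)
  have hi := integrable_exp_neg_mul_sq (b := 1 / 2) (by norm_num)
  rw [← ofReal_integral_eq_lintegral_ofReal, ← show Real.pi / (1 / 2) = 2 * Real.pi by ring, ← h]
  · congr 2; ext y; congr 1; ring
  · convert hi using 3; ring
  · exact Filter.Eventually.of_forall fun y => (Real.exp_pos _).le

/-- The inverse Gaussian integral for a positive parameter, by the Cauchy–Schlömilch substitution
`y = √t - q / √t` together with the inversion `t ↦ q² / t`. -/
theorem lintegral_invGaussian_of_pos {q : ℝ} (hq : 0 < q) :
    ∫⁻ t in Set.Ioi (0 : ℝ), ENNReal.ofReal (Real.exp (-(1 / 2) * (t + q ^ 2 / t)) / Real.sqrt t) =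
      ENNReal.ofReal (Real.sqrt (2 * Real.pi) * Real.exp (-q)) := by
  set F : ℝ → ℝ := fun t => Real.exp (-(1 / 2) * (t + q ^ 2 / t)) / Real.sqrt t with hF
  have hFm : Measurable F := by fun_prop
  set I := ∫⁻ t in Set.Ioi (0 : ℝ), ENNReal.ofReal (F t) with hI
  -- inversion
  have hinv : ∫⁻ t in Set.Ioi (0 : ℝ), ENNReal.ofReal (F t * (q / t)) = I := by
    have himg : (fun s : ℝ => q ^ 2 / s) '' Set.Ioi (0 : ℝ) = Set.Ioi (0 : ℝ) := by
      ext t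
      constructor
      · rintro ⟨s, hs, rfl⟩
        exact div_pos (by positivity : 0 < q ^ 2) hs
      · intro ht
        have ht' : (0 : ℝ) < t := ht
        refine ⟨q ^ 2 / t, div_pos (by positivity : 0 < q ^ 2) ht, ?_⟩
        change q ^ 2 / (q ^ 2 / t) = t
        field_simp
    have hcv := lintegral_image_eq_lintegral_abs_deriv_mul (s := Set.Ioi (0 : ℝ))
      (f := fun s : ℝ => q ^ 2 / s) (f' := fun s => -(q ^ 2) / s ^ 2) measurableSet_Ioi
      (fun s hs => by
        have hs' : s ≠ 0 := ne_of_gt hs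
        refine HasDerivAt.hasDerivWithinAt ?_
        convert! (hasDerivAt_const s (q ^ 2)).div (hasDerivAt_id s) hs' using 1
        simp)
      (fun a ha b hb hab => by
        have ha' : (0 : ℝ) < a := ha
        have hb' : (0 : ℝ) < b := hb
        have : q ^ 2 / a = q ^ 2 / b := hab
        field_simp at this
        exact this.symm)
      (fun t => ENNReal.ofReal (F t * (q / t)))
    rw [himg] at hcv
    rw [hcv]
    refine setLIntegral_congr_fun measurableSet_Ioi fun s hs => ?_
    have hs' : (0 : ℝ) < s := hs
    change ENNReal.ofReal |-(q ^ 2) / s ^ 2| *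
      ENNReal.ofReal (F (q ^ 2 / s) * (q / (q ^ 2 / s))) = _
    rw [← ENNReal.ofReal_mul (abs_nonneg _)]
    congr 1
    have hsq : Real.sqrt s * Real.sqrt s = s := Real.mul_self_sqrt hs'.le
    have hsp : 0 < Real.sqrt s := Real.sqrt_pos.2 hs'
    simp only [hF]
    rw [abs_div, abs_neg, abs_of_pos (by positivity : 0 < q ^ 2),
      abs_of_pos (by positivity : 0 < s ^ 2),
      Real.sqrt_div (by positivity), Real.sqrt_sq hq.le,
      show q ^ 2 / s + q ^ 2 / (q ^ 2 / s) = s + q ^ 2 / s by field_simp; ring]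
    field_simp
    nlinarith
  -- the substitution `y = √t - q / √t`
  have hsub : ENNReal.ofReal (Real.sqrt (2 * Real.pi)) = ENNReal.ofReal (Real.exp q) * I := by
    have himg : (fun t : ℝ => Real.sqrt t - q / Real.sqrt t) '' Set.Ioi 0 = Set.univ := by
      refine Set.eq_univ_of_forall fun y => ?_
      set w := Real.sqrt (y ^ 2 + 4 * q) with hw
      have hw2 : w ^ 2 = y ^ 2 + 4 * q := Real.sq_sqrt (by positivity)
      have hw0 : 0 ≤ w := Real.sqrt_nonneg _
      have hpos : 0 < (y + w) / 2 := by
        have : |y| < w := by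
          rw [hw]; apply Real.lt_sqrt_of_sq_lt; rw [sq_abs]; linarith
        have := neg_abs_le y
        linarith
      refine ⟨((y + w) / 2) ^ 2, by change 0 < ((y + w) / 2) ^ 2; positivity, ?_⟩
      change Real.sqrt (((y + w) / 2) ^ 2) - q / Real.sqrt (((y + w) / 2) ^ 2) = y
      rw [Real.sqrt_sq hpos.le]
      have : y + w ≠ 0 := by intro h; rw [h] at hpos; simp at hpos
      field_simp
      nlinarith
    have hcv := lintegral_image_eq_lintegral_abs_deriv_mul (s := Set.Ioi (0 : ℝ))
      (f := fun t : ℝ => Real.sqrt t - q / Real.sqrt t)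
      (f' := fun t => 1 / (2 * Real.sqrt t) + q / t * (1 / (2 * Real.sqrt t))) measurableSet_Ioi
      (fun t ht => by
        have ht' : (0 : ℝ) < t := ht
        have hs := Real.hasDerivAt_sqrt ht'.ne'
        have h2 := (hasDerivAt_const t q).div hs (Real.sqrt_pos.2 ht').ne'
        refine HasDerivAt.hasDerivWithinAt ?_
        convert! hs.sub h2 using 1
        rw [Real.sq_sqrt ht'.le]
        ring)
      (fun a ha b hb hab => by
        have ha' : (0 : ℝ) < a := ha
        have hb' : (0 : ℝ) < b := hb
        have h : Real.sqrt a - q / Real.sqrt a = Real.sqrt b - q / Real.sqrt b := hab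
        have hsa := Real.sqrt_pos.2 ha'
        have hsb := Real.sqrt_pos.2 hb'
        by_contra hne
        rcases lt_or_gt_of_ne hne with hlt | hlt
        · have := Real.sqrt_lt_sqrt ha'.le hlt
          have := div_lt_div_of_pos_left hq hsa this
          linarith
        · have := Real.sqrt_lt_sqrt hb'.le hlt
          have := div_lt_div_of_pos_left hq hsb this
          linarith)
      (fun y => ENNReal.ofReal (Real.exp (-y ^ 2 / 2)))
    rw [himg, Measure.restrict_univ, lintegral_exp_neg_sq_div_two] at hcv
    have hsplit : ∀ t ∈ Set.Ioi (0 : ℝ),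
        ENNReal.ofReal |1 / (2 * Real.sqrt t) + q / t * (1 / (2 * Real.sqrt t))| *
          ENNReal.ofReal (Real.exp (-(Real.sqrt t - q / Real.sqrt t) ^ 2 / 2)) =
        ENNReal.ofReal (Real.exp q / 2) *
          (ENNReal.ofReal (F t) + ENNReal.ofReal (F t * (q / t))) := by
      intro t ht
      have ht' : (0 : ℝ) < t := ht
      have hsp := Real.sqrt_pos.2 ht'
      have hsq := Real.sq_sqrt ht'.le
      rw [← ENNReal.ofReal_add (by positivity) (by positivity),
        ← ENNReal.ofReal_mul (by positivity), ← ENNReal.ofReal_mul (by positivity),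
        abs_of_pos (by positivity)]
      congr 1
      have : -(Real.sqrt t - q / Real.sqrt t) ^ 2 / 2 = q + -(1 / 2) * (t + q ^ 2 / t) := by
        have e1 : (Real.sqrt t - q / Real.sqrt t) ^ 2 = t - 2 * q + q ^ 2 / t := by
          rw [sub_sq, div_pow, hsq]
          field_simp
        rw [e1]; ring
      rw [this, Real.exp_add]
      simp only [hF]
      field_simp
    rw [setLIntegral_congr_fun measurableSet_Ioi hsplit, lintegral_const_mul _ (by fun_prop),
      lintegral_add_left (by fun_prop), hinv, ← hI, ← two_mul, ← mul_assoc] at hcv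
    rw [hcv]
    congr 1
    rw [← ENNReal.ofReal_ofNat 2, ← ENNReal.ofReal_mul (by positivity)]
    congr 1; ring
  rw [ENNReal.ofReal_mul (by positivity), hsub, mul_right_comm,
    ← ENNReal.ofReal_mul (by positivity), ← Real.exp_add]
  simp

theorem lintegral_invGaussian {q : ℝ} (hq : 0 ≤ q) :
    ∫⁻ t in Set.Ioi (0 : ℝ), ENNReal.ofReal (Real.exp (-(1 / 2) * (t + q ^ 2 / t)) / Real.sqrt t) =
      ENNReal.ofReal (Real.sqrt (2 * Real.pi) * Real.exp (-q)) := by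
  rcases hq.eq_or_lt with rfl | hq
  · have h := Real.integral_rpow_mul_exp_neg_mul_Ioi (a := 1 / 2) (r := 1 / 2) (by norm_num)
      (by norm_num)
    have hne : ∫ t in Set.Ioi (0 : ℝ), t ^ ((1 : ℝ) / 2 - 1) * Real.exp (-(1 / 2 * t)) ≠ 0 := by
      rw [h]
      have := Real.Gamma_pos_of_pos (s := 1 / 2) (by norm_num)
      positivity
    have hint : IntegrableOn (fun t : ℝ => t ^ ((1 : ℝ) / 2 - 1) * Real.exp (-(1 / 2 * t)))
        (Set.Ioi 0) := by
      by_contra hcon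
      exact hne (integral_undef hcon)
    have hval : ∫ t in Set.Ioi (0 : ℝ), t ^ ((1 : ℝ) / 2 - 1) * Real.exp (-(1 / 2 * t)) =
        Real.sqrt (2 * Real.pi) * Real.exp (-0) := by
      rw [h, Real.Gamma_one_half_eq, ← Real.sqrt_eq_rpow, ← Real.sqrt_mul (by norm_num)]
      simp
    rw [← hval, ofReal_integral_eq_lintegral_ofReal hint]
    · refine setLIntegral_congr_fun measurableSet_Ioi fun t ht => ?_
      have ht' : (0 : ℝ) < t := ht
      change ENNReal.ofReal _ = ENNReal.ofReal _
      congr 1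
      rw [show (1 : ℝ) / 2 - 1 = -(1 / 2) by norm_num, Real.rpow_neg ht'.le, ← Real.sqrt_eq_rpow,
        mul_comm _ (Real.exp _), ← div_eq_mul_inv]
      congr 2
      ring
    · refine (ae_restrict_iff' measurableSet_Ioi).2 (Filter.Eventually.of_forall fun t ht => ?_)
      have ht' : (0 : ℝ) < t := ht
      positivity
  · exact lintegral_invGaussian_of_pos hq

/-! ### Bounded random variables are determined by their moments -/

open scoped BoundedContinuousFunction in
/-- Two finite measures for which one injective bounded continuous function has the same moments
coincide: the polynomials in that function form an algebra separating points. -/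
theorem ext_of_moments_eq {E : Type*} [TopologicalSpace E] [PolishSpace E] [MeasurableSpace E]
    [BorelSpace E] {μ ν : Measure E} [IsFiniteMeasure μ] [IsFiniteMeasure ν] (f : E →ᵇ ℝ)
    (hf : Function.Injective f) (h : ∀ k : ℕ, ∫ x, f x ^ k ∂μ = ∫ x, f x ^ k ∂ν) : μ = ν := by
  refine ext_of_forall_mem_subalgebra_integral_eq_of_polish (𝕜 := ℝ)
    (A := StarAlgebra.adjoin ℝ {f}) ?_ ?_
  · intro x y hxy
    refine ⟨f, ⟨f.toContinuousMap, ⟨f, StarAlgebra.self_mem_adjoin_singleton ℝ f, rfl⟩, rfl⟩, ?_⟩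
    exact fun heq => hxy (hf heq)
  · intro g hg
    have hg' : g ∈ Algebra.adjoin ℝ {f} := by
      have : (StarAlgebra.adjoin ℝ {f}).toSubalgebra = Algebra.adjoin ℝ {f} := by
        have hstar : star f = f := by ext x; simp
        rw [StarAlgebra.adjoin_toSubalgebra, Set.star_singleton, hstar, Set.union_self]
      rw [← this]; exact hg
    rw [Algebra.adjoin_singleton_eq_range_aeval] at hg'
    obtain ⟨p, rfl⟩ := hg'
    have hp : ∀ x, (Polynomial.aeval f p : E →ᵇ ℝ) x = ∑ k ∈ Finset.range (p.natDegree + 1),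
        p.coeff k * f x ^ k := by
      intro x
      rw [Polynomial.aeval_eq_sum_range]
      simp
    have hint : ∀ (ρ : Measure E) [IsFiniteMeasure ρ] (k : ℕ),
        Integrable (fun x => f x ^ k) ρ := by
      intro ρ _ k
      exact (f ^ k).integrable ρ
    change ∫ x, (Polynomial.aeval f p : E →ᵇ ℝ) x ∂μ = ∫ x, (Polynomial.aeval f p : E →ᵇ ℝ) x ∂ν
    simp_rw [hp]
    rw [integral_finsetSum _ fun k _ => (hint μ k).const_mul _,
      integral_finsetSum _ fun k _ => (hint ν k).const_mul _]
    simp_rw [integral_const_mul, h]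

/-! ### Measurability of matrix operations -/

section Measurability

variable {α n : Type*} [MeasurableSpace α] [Fintype n]

theorem measurable_dotProduct_mulVec {M : α → Matrix n n ℝ}
    (hM : ∀ i j, Measurable fun a => M a i j) {u v : α → n → ℝ} (hu : Measurable u)
    (hv : Measurable v) : Measurable fun a => u a ⬝ᵥ (M a *ᵥ v a) := by
  simp only [dotProduct, mulVec]
  fun_prop

variable [DecidableEq n]

theorem measurable_det_of_entries {M : α → Matrix n n ℝ}
    (hM : ∀ i j, Measurable fun a => M a i j) : Measurable fun a => (M a).det := by
  simp only [det_apply]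
  fun_prop

theorem measurable_inv_of_entries {M : α → Matrix n n ℝ}
    (hM : ∀ i j, Measurable fun a => M a i j) (i j : n) : Measurable fun a => (M a)⁻¹ i j := by
  simp only [inv_def, Ring.inverse_eq_inv', Matrix.smul_apply, smul_eq_mul, adjugate_apply]
  refine (measurable_det_of_entries hM).inv.mul (measurable_det_of_entries fun k l => ?_)
  by_cases hk : k = j
  · subst hk
    simp
  · simpa [updateRow_ne hk] using hM k l

/-- Positive definiteness is a measurable condition: it is semidefiniteness, a closed condition,
together with nonvanishing determinant. -/
theorem measurableSet_posDef {M : α → Matrix n n ℝ} (hM : ∀ i j, Measurable fun a => M a i j) :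
    MeasurableSet {a | (M a).PosDef} := by
  have hcl : IsClosed {f : n → n → ℝ | (Matrix.of f).PosSemidef} := by
    have : {f : n → n → ℝ | (Matrix.of f).PosSemidef} =
        {f | (Matrix.of f)ᵀ = Matrix.of f} ∩ ⋂ x : n → ℝ, {f | 0 ≤ x ⬝ᵥ (Matrix.of f *ᵥ x)} := by
      ext f
      simp [posSemidef_iff_dotProduct_mulVec, IsHermitian]
    rw [this]
    refine IsClosed.inter (isClosed_eq ?_ ?_)
      (isClosed_iInter fun x => isClosed_le continuous_const ?_)
    · exact continuous_matrix fun i j => by simp only [transpose_apply, of_apply]; fun_prop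
    · exact continuous_matrix fun i j => by simp only [of_apply]; fun_prop
    · simp only [dotProduct, mulVec, of_apply]; fun_prop
  have hps : MeasurableSet {a | (M a).PosSemidef} :=
    (measurable_pi_lambda _ fun i => measurable_pi_lambda _ fun j => hM i j :
      Measurable fun a => (fun i j => M a i j : n → n → ℝ)) hcl.measurableSet
  have : {a | (M a).PosDef} = {a | (M a).PosSemidef} ∩ {a | (M a).det = 0}ᶜ := by
    ext a
    constructor
    · exact fun h => ⟨h.posSemidef, h.det_pos.ne'⟩
    · exact fun h => h.1.posDef_iff_det_ne_zero.2 h.2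
  rw [this]
  exact hps.inter (measurable_det_of_entries hM (measurableSet_singleton 0)).compl

theorem measurable_schrodinger {V : Type*} [DecidableEq V] (𝒢 : WeightedGraph V) (i j : V) :
    Measurable fun β : V → ℝ => schrodinger 𝒢 β i j := by
  simp only [schrodinger, Matrix.sub_apply, diagonal_apply, of_apply]
  split_ifs <;> fun_prop

theorem measurable_density {V : Type*} [Fintype V] [DecidableEq V] (𝒢 : WeightedGraph V)
    (η : V → ℝ) : Measurable (density 𝒢 η) := by
  have h1 := measurable_schrodinger 𝒢
  have h2 := measurable_dotProduct_mulVec h1 (u := fun _ => 1) (v := fun _ => 1)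
    measurable_const measurable_const
  have h3 := measurable_dotProduct_mulVec (measurable_inv_of_entries h1) (u := fun _ => η)
    (v := fun _ => η) measurable_const measurable_const
  have h4 := measurable_det_of_entries h1
  unfold density
  refine Measurable.ite (measurableSet_posDef h1) ?_ measurable_const
  fun_prop

end Measurability

/-! ### Schur complements and conditional densities -/

section Conditional

variable {V m n : Type*}

/-- The pullback of a weighted graph along a map of vertex sets; along an injection this is the
induced subgraph. -/
def WeightedGraph.comap {m V : Type*} (𝒢 : WeightedGraph V) (f : m → V) : WeightedGraph m where
  weight i j := 𝒢.weight (f i) (f j)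
  symm i j := 𝒢.symm (f i) (f j)
  nonneg i j := 𝒢.nonneg (f i) (f j)
  loopless i := 𝒢.loopless (f i)

/-- The potential on `V` with restrictions `x` and `y` to the two parts of a splitting
`m ⊕ n ≃ V`. -/
def join {V m n : Type*} (e : m ⊕ n ≃ V) (x : m → ℝ) (y : n → ℝ) : V → ℝ :=
  fun v => Sum.elim x y (e.symm v)

/-- The weights between the two parts of a splitting `m ⊕ n ≃ V`. -/
def crossWeight {V m n : Type*} (𝒢 : WeightedGraph V) (e : m ⊕ n ≃ V) : Matrix m n ℝ :=
  Matrix.of fun i j => 𝒢.weight (e (Sum.inl i)) (e (Sum.inr j))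

theorem schrodinger_join [DecidableEq V] [DecidableEq m] [DecidableEq n] (𝒢 : WeightedGraph V)
    (e : m ⊕ n ≃ V) (x : m → ℝ) (y : n → ℝ) :
    (schrodinger 𝒢 (join e x y)).submatrix e e =
      fromBlocks (schrodinger (𝒢.comap (e ∘ Sum.inl)) x) (-crossWeight 𝒢 e)
        (-(crossWeight 𝒢 e)ᵀ) (schrodinger (𝒢.comap (e ∘ Sum.inr)) y) := by
  ext (i | i) (j | j) <;>
    simp [schrodinger, join, crossWeight, WeightedGraph.comap, diagonal_apply, 𝒢.symm]

theorem posDef_submatrix_equiv_iff (e : m ≃ V) (M : Matrix V V ℝ) :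
    (M.submatrix e e).PosDef ↔ M.PosDef :=
  ⟨fun h => by simpa using h.submatrix e.symm.injective, fun h => h.submatrix e.injective⟩

variable [Fintype V] [Fintype m] [Fintype n]

theorem dotProduct_mulVec_submatrix (e : m ≃ V) (M : Matrix V V ℝ) (u : V → ℝ) :
    u ⬝ᵥ (M *ᵥ u) = (u ∘ e) ⬝ᵥ (M.submatrix e e *ᵥ (u ∘ e)) := by
  simp only [dotProduct, mulVec, submatrix_apply, Function.comp_apply]
  rw [← e.sum_comp]
  refine Finset.sum_congr rfl fun i _ => ?_
  rw [← e.sum_comp]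

theorem measurePreserving_join (e : m ⊕ n ≃ V) :
    MeasurePreserving (fun p : (m → ℝ) × (n → ℝ) => join e p.1 p.2) volume volume := by
  have h := (volume_measurePreserving_piCongrLeft (fun _ : V => ℝ) e).comp
    (volume_measurePreserving_sumPiEquivProdPi_symm (fun _ : m ⊕ n => ℝ))
  convert! h using 1
  ext p v
  obtain ⟨i, rfl⟩ := e.surjective v
  simp only [join, Equiv.symm_apply_apply, Function.comp_apply, MeasurableEquiv.coe_piCongrLeft,
    Equiv.piCongrLeft_apply_apply]
  cases i <;> rfl

theorem measurable_join (e : m ⊕ n ≃ V) :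
    Measurable fun p : (m → ℝ) × (n → ℝ) => join e p.1 p.2 :=
  (measurePreserving_join e).measurable

theorem lintegral_join (e : m ⊕ n ≃ V) {F : (V → ℝ) → ENNReal} (hF : Measurable F) :
    ∫⁻ β, F β = ∫⁻ x, ∫⁻ y, F (join e x y) := by
  rw [← (measurePreserving_join e).lintegral_comp hF, Measure.volume_eq_prod,
    lintegral_prod _ (show Measurable fun p : (m → ℝ) × (n → ℝ) => F (join e p.1 p.2) from
      hF.comp (measurable_join e)).aemeasurable]

theorem lintegral_join_symm (e : m ⊕ n ≃ V) {F : (V → ℝ) → ENNReal} (hF : Measurable F) :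
    ∫⁻ β, F β = ∫⁻ y, ∫⁻ x, F (join e x y) := by
  rw [← (measurePreserving_join e).lintegral_comp hF, Measure.volume_eq_prod,
    lintegral_prod_symm _ (show Measurable fun p : (m → ℝ) × (n → ℝ) => F (join e p.1 p.2) from
      hF.comp (measurable_join e)).aemeasurable]

variable [DecidableEq V] [DecidableEq m] [DecidableEq n]

open Classical in
/-- The density, in the potential `x` on `m`, attached to the Schur complement `H_x - M`, where
`H_x` is the Schrödinger matrix on `m`; the vector `ζ` plays the part of the boundary condition,
and `c` collects the terms that do not depend on `x`. With the values of `M`, `ζ` and `c` given in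
`density_join` it is the factor by which a larger model differs from the model without boundary
condition on the eliminated vertices. -/
noncomputable def condDensity (𝒢 : WeightedGraph m) (M : Matrix m m ℝ) (ζ : m → ℝ) (c : ℝ)
    (x : m → ℝ) : ℝ :=
  if (schrodinger 𝒢 x - M).PosDef then
    Real.sqrt (2 / Real.pi) ^ Fintype.card m *
      Real.exp (-(1 / 2) * ((1 : m → ℝ) ⬝ᵥ (schrodinger 𝒢 x *ᵥ (1 : m → ℝ))
        + ζ ⬝ᵥ ((schrodinger 𝒢 x - M)⁻¹ *ᵥ ζ)) + c) /
      Real.sqrt (schrodinger 𝒢 x - M).det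
  else 0

theorem measurable_condDensity {α : Type*} [MeasurableSpace α] (𝒢 : WeightedGraph m)
    {M : α → Matrix m m ℝ} (hM : ∀ i j, Measurable fun a => M a i j) {ζ : α → m → ℝ}
    (hζ : Measurable ζ) {c : α → ℝ} (hc : Measurable c) {x : α → m → ℝ} (hx : Measurable x) :
    Measurable fun a => condDensity 𝒢 (M a) (ζ a) (c a) (x a) := by
  have h1 : ∀ i j, Measurable fun a => schrodinger 𝒢 (x a) i j :=
    fun i j => (measurable_schrodinger 𝒢 i j).comp hx
  have h2 := measurable_dotProduct_mulVec h1 (u := fun _ => 1) (v := fun _ => 1)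
    measurable_const measurable_const
  have h3 : ∀ i j, Measurable fun a => (schrodinger 𝒢 (x a) - M a) i j :=
    fun i j => (h1 i j).sub (hM i j)
  have h4 := measurable_dotProduct_mulVec (measurable_inv_of_entries h3) hζ hζ
  have h5 := measurable_det_of_entries h3
  unfold condDensity
  refine Measurable.ite (measurableSet_posDef h3) ?_ measurable_const
  fun_prop

/-- The factorization of the density along a splitting of the vertex set, by block Gaussian
elimination. -/
theorem density_join (𝒢 : WeightedGraph V) (η : V → ℝ) (e : m ⊕ n ≃ V) (x : m → ℝ)
    (y : n → ℝ) {B : Matrix m n ℝ} (hB : B = crossWeight 𝒢 e) {D : Matrix n n ℝ}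
    (hD : D = schrodinger (𝒢.comap (e ∘ Sum.inr)) y) {ηm : m → ℝ} (hm : ηm = η ∘ e ∘ Sum.inl)
    {ηn : n → ℝ} (hn : ηn = η ∘ e ∘ Sum.inr) :
    density 𝒢 η (join e x y) = density (𝒢.comap (e ∘ Sum.inr)) 0 y *
      condDensity (𝒢.comap (e ∘ Sum.inl)) (B * D⁻¹ * Bᵀ) (ηm + B *ᵥ (D⁻¹ *ᵥ ηn))
        ((1 : m → ℝ) ⬝ᵥ (B *ᵥ (1 : n → ℝ)) - (1 / 2) * (ηn ⬝ᵥ (D⁻¹ *ᵥ ηn))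
          + (1 : m → ℝ) ⬝ᵥ ηm + (1 : n → ℝ) ⬝ᵥ ηn) x := by
  set A := schrodinger (𝒢.comap (e ∘ Sum.inl)) x with hA
  have hblocks := schrodinger_join 𝒢 e x y
  rw [← hA, ← hB, ← hD] at hblocks
  have hpos : (schrodinger 𝒢 (join e x y)).PosDef ↔ D.PosDef ∧ (A - B * D⁻¹ * Bᵀ).PosDef := by
    rw [← posDef_submatrix_equiv_iff e, hblocks, posDef_fromBlocks_iff]
  unfold density condDensity
  rw [← hD, ← hA]
  by_cases h : D.PosDef ∧ (A - B * D⁻¹ * Bᵀ).PosDef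
  · have hη : η ∘ e = Sum.elim ηm ηn := by
      rw [hm, hn]; ext (i | i) <;> rfl
    have h1 : (1 : V → ℝ) ∘ e = Sum.elim (1 : m → ℝ) (1 : n → ℝ) := by ext (i | i) <;> rfl
    have hdet : (schrodinger 𝒢 (join e x y)).det = D.det * (A - B * D⁻¹ * Bᵀ).det := by
      rw [← det_submatrix_equiv_self e, hblocks, det_fromBlocks_schur A B h.1]
    have hquad : η ⬝ᵥ ((schrodinger 𝒢 (join e x y))⁻¹ *ᵥ η) =
        ηn ⬝ᵥ (D⁻¹ *ᵥ ηn) + (ηm + B *ᵥ (D⁻¹ *ᵥ ηn)) ⬝ᵥ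
          ((A - B * D⁻¹ * Bᵀ)⁻¹ *ᵥ (ηm + B *ᵥ (D⁻¹ *ᵥ ηn))) := by
      rw [dotProduct_mulVec_submatrix e, ← inv_submatrix_equiv, hblocks, hη,
        dotProduct_inv_fromBlocks A B h.1 h.2]
    have hone : (1 : V → ℝ) ⬝ᵥ (schrodinger 𝒢 (join e x y) *ᵥ (1 : V → ℝ)) =
        (1 : m → ℝ) ⬝ᵥ (A *ᵥ (1 : m → ℝ)) + (1 : n → ℝ) ⬝ᵥ (D *ᵥ (1 : n → ℝ))
          - 2 * ((1 : m → ℝ) ⬝ᵥ (B *ᵥ (1 : n → ℝ))) := by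
      have ht : (1 : n → ℝ) ⬝ᵥ (Bᵀ *ᵥ (1 : m → ℝ)) = (1 : m → ℝ) ⬝ᵥ (B *ᵥ (1 : n → ℝ)) := by
        rw [mulVec_transpose, dotProduct_comm, ← dotProduct_mulVec]
      rw [dotProduct_mulVec_submatrix e, hblocks, h1, fromBlocks_mulVec, sumElim_dotProduct_sumElim]
      simp only [Sum.elim_comp_inl, Sum.elim_comp_inr, dotProduct_add, neg_mulVec, dotProduct_neg,
        ht]
      ring
    have hlin : (1 : V → ℝ) ⬝ᵥ η = (1 : m → ℝ) ⬝ᵥ ηm + (1 : n → ℝ) ⬝ᵥ ηn := by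
      have : (1 : V → ℝ) ⬝ᵥ η = ((1 : V → ℝ) ∘ e) ⬝ᵥ (η ∘ e) := by
        simp only [dotProduct, Function.comp_apply]
        rw [← e.sum_comp]
      rw [this, h1, hη, sumElim_dotProduct_sumElim]
    have hcard : Fintype.card V = Fintype.card n + Fintype.card m := by
      rw [← Fintype.card_congr e, Fintype.card_sum, add_comm]
    rw [if_pos (hpos.2 h), if_pos h.1, if_pos h.2, hdet, hquad, hone, hlin, hcard, pow_add,
      Real.sqrt_mul h.1.det_pos.le, div_mul_div_comm, mul_mul_mul_comm, ← Real.exp_add]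
    congr 3
    simp only [zero_dotProduct, dotProduct_zero]
    ring
  · rw [if_neg (fun h' => h (hpos.1 h'))]
    by_cases h1 : D.PosDef
    · rw [if_neg (fun h2 => h ⟨h1, h2⟩), mul_zero]
    · rw [if_neg h1, zero_mul]

end Conditional

/-! ### Normalization of the density -/

section Normalization

theorem density_eq_zero_of_not_posDef {V : Type*} [Fintype V] [DecidableEq V]
    {𝒢 : WeightedGraph V} {η β : V → ℝ} (h : ¬(schrodinger 𝒢 β).PosDef) : density 𝒢 η β = 0 :=
  if_neg h

theorem density_nonneg {V : Type*} [Fintype V] [DecidableEq V]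
    (𝒢 : WeightedGraph V) (η β : V → ℝ) : 0 ≤ density 𝒢 η β := by
  unfold density
  split_ifs <;> positivity

theorem density_eq_density_zero_mul {V : Type*} [Fintype V] [DecidableEq V]
    (𝒢 : WeightedGraph V) (η β : V → ℝ) :
    density 𝒢 η β = density 𝒢 0 β *
      Real.exp (-(1 / 2) * (η ⬝ᵥ ((schrodinger 𝒢 β)⁻¹ *ᵥ η)) + (1 : V → ℝ) ⬝ᵥ η) := by
  unfold density
  split_ifs
  · rw [div_mul_eq_mul_div, mul_assoc, ← Real.exp_add]
    congr 3
    simp only [zero_dotProduct, dotProduct_zero]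
    ring
  · rw [zero_mul]

theorem schrodinger_apply_nonpos {V : Type*} [DecidableEq V] (𝒢 : WeightedGraph V) (β : V → ℝ)
    {i j : V} (h : i ≠ j) : schrodinger 𝒢 β i j ≤ 0 := by
  simp [schrodinger, h, 𝒢.nonneg i j]

/-- For a single remaining vertex, the conditional density is an inverse Gaussian integrand in the
variable `2 x - M`. -/
theorem lintegral_condDensity_of_unique {m : Type*} [Unique m] [Fintype m] [DecidableEq m]
    (𝒢 : WeightedGraph m) (M : Matrix m m ℝ) {ζ : m → ℝ} (hζ : 0 ≤ ζ default) (c : ℝ) :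
    ∫⁻ x, ENNReal.ofReal (condDensity 𝒢 M ζ c x) =
      ENNReal.ofReal (Real.exp (c - ζ default - (1 / 2) * M default default)) := by
  obtain rfl : ‹Fintype m› = Unique.fintype := Subsingleton.elim _ _
  set q := ζ default with hq
  set r := M default default with hr
  have hcard : Fintype.card m = 1 :=
    Fintype.card_eq_one_iff.2 ⟨default, fun y => Subsingleton.elim _ _⟩
  have huniv : (Finset.univ : Finset m) = {default} := by
    ext i; simp [Subsingleton.elim i default]
  set G : ℝ → ENNReal := Set.indicator (Set.Ioi 0) fun t =>
    ENNReal.ofReal (Real.sqrt (2 / Real.pi) * Real.exp (c - (1 / 2) * r)) *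
      ENNReal.ofReal (Real.exp (-(1 / 2) * (t + q ^ 2 / t)) / Real.sqrt t) with hG
  have hval : ∀ x : m → ℝ, ENNReal.ofReal (condDensity 𝒢 M ζ c x) = G (2 * x default - r) := by
    intro x
    have hH : schrodinger 𝒢 x = diagonal fun _ => 2 * x default := by
      ext i j
      rw [Subsingleton.elim i default, Subsingleton.elim j default]
      simp [schrodinger, 𝒢.loopless]
    have hS : schrodinger 𝒢 x - M = diagonal fun _ => 2 * x default - r := by
      rw [hH]
      ext i j
      rw [Subsingleton.elim i default, Subsingleton.elim j default]
      simp [hr]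
    have hpos : (schrodinger 𝒢 x - M).PosDef ↔ 0 < 2 * x default - r := by
      rw [hS, posDef_diagonal_iff]
      exact ⟨fun h => h default, fun h _ => h⟩
    unfold condDensity
    by_cases h : 0 < 2 * x default - r
    · rw [if_pos (hpos.2 h), hG, Set.indicator_of_mem (show 2 * x default - r ∈ Set.Ioi 0 from h),
        ← ENNReal.ofReal_mul (by positivity), hS, hH, hcard, det_diagonal]
      congr 1
      have hinv : (diagonal fun _ : m => 2 * x default - r)⁻¹ =
          diagonal fun _ => (2 * x default - r)⁻¹ :=
        inv_eq_right_inv (by rw [diagonal_mul_diagonal]; simp [h.ne'])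
      rw [hinv]
      simp only [dotProduct, mulVec_diagonal, huniv, Finset.sum_singleton, Finset.prod_singleton,
        Pi.one_apply, ← hq, pow_one, one_mul, mul_one]
      rw [← mul_div_assoc, mul_assoc, ← Real.exp_add]
      congr 3
      field_simp
      ring
    · rw [if_neg (fun h' => h (hpos.1 h')), ENNReal.ofReal_zero, hG,
        Set.indicator_of_notMem (show 2 * x default - r ∉ Set.Ioi 0 from h)]
  have hlin : ∫⁻ t, G t = ENNReal.ofReal 2 * ∫⁻ b, G (2 * b - r) := by
    have himg : (fun b : ℝ => 2 * b - r) '' Set.univ = Set.univ :=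
      Set.eq_univ_of_forall fun t => ⟨(t + r) / 2, trivial, by
        change 2 * ((t + r) / 2) - r = t
        ring⟩
    have h := lintegral_image_eq_lintegral_abs_deriv_mul (s := Set.univ)
      (f := fun b : ℝ => 2 * b - r) (f' := fun _ => 2) MeasurableSet.univ
      (fun b _ => by
        refine HasDerivAt.hasDerivWithinAt ?_
        convert! ((hasDerivAt_id b).const_mul 2).sub_const r using 1
        simp)
      (fun a _ b _ hab => by
        have : 2 * a - r = 2 * b - r := hab
        linarith) G
    rw [himg, Measure.restrict_univ] at h
    rw [h, lintegral_const_mul' _ _ ENNReal.ofReal_ne_top]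
    simp
  have hGint : ∫⁻ t, G t = ENNReal.ofReal 2 * ENNReal.ofReal (Real.exp (c - q - (1 / 2) * r)) := by
    rw [hG, lintegral_indicator measurableSet_Ioi, lintegral_const_mul' _ _ ENNReal.ofReal_ne_top,
      lintegral_invGaussian hζ, ← ENNReal.ofReal_mul (by positivity),
      ← ENNReal.ofReal_mul (by positivity)]
    congr 1
    have h2 : Real.sqrt (2 / Real.pi) * Real.sqrt (2 * Real.pi) = 2 := by
      rw [← Real.sqrt_mul (by positivity), show 2 / Real.pi * (2 * Real.pi) = 2 ^ 2 by
        field_simp, Real.sqrt_sq (by norm_num)]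
    rw [mul_mul_mul_comm, h2, ← Real.exp_add]
    congr 2
    ring
  rw [lintegral_congr hval]
  have hfu := (volume_preserving_funUnique m ℝ).lintegral_comp_emb
    (MeasurableEquiv.funUnique m ℝ).measurableEmbedding (fun b => G (2 * b - r))
  change ∫⁻ x : m → ℝ, G (2 * x default - r) = _ at hfu
  rw [hfu]
  have := hlin.symm.trans hGint
  exact (ENNReal.mul_right_inj (by simp) ENNReal.ofReal_ne_top).1 this

/-- The density integrates to one. Integrating out the potential at one vertex `v` turns the model
with boundary condition `η` into the one on the other vertices with boundary condition
`η + W_{v,·}`; nonnegativity of `H⁻¹` enters through the sign of the inverse Gaussian parameter. -/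
theorem lintegral_density {V : Type*} [Fintype V] [DecidableEq V] (𝒢 : WeightedGraph V)
    {η : V → ℝ} (hη : ∀ i, 0 ≤ η i) : ∫⁻ β, ENNReal.ofReal (density 𝒢 η β) = 1 := by
  obtain ⟨N, hN⟩ : ∃ N, Fintype.card V = N := ⟨_, rfl⟩
  induction N generalizing V with
  | zero =>
    have : IsEmpty V := Fintype.card_eq_zero_iff.1 hN
    have hd : ∀ β, density 𝒢 η β = 1 := by
      intro β
      have hpd : (schrodinger 𝒢 β).PosDef := by
        rw [Subsingleton.elim (schrodinger 𝒢 β) 1]; exact PosDef.one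
      unfold density
      rw [if_pos hpd, hN]
      simp [dotProduct]
    simp_rw [hd]
    simp [volume_pi]
  | succ N ih =>
    have : Nonempty V := Fintype.card_pos_iff.1 (by omega)
    obtain ⟨v⟩ := this
    set e : {a // a = v} ⊕ {a // ¬a = v} ≃ V := Equiv.sumCompl fun a => a = v
    set 𝒢' := 𝒢.comap (e ∘ Sum.inr)
    set w : {a // ¬a = v} → ℝ := fun j => 𝒢.weight v j with hw
    set ηn : {a // ¬a = v} → ℝ := η ∘ e ∘ Sum.inr with hηn
    have hcard : Fintype.card {a // ¬a = v} = N := by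
      rw [Fintype.card_subtype_compl, hN]; simp
    -- the potential at `v` is integrated first, against the frozen potential `y` elsewhere
    rw [← ih 𝒢' (η := ηn + w) (fun i => add_nonneg (hη _) (𝒢.nonneg _ _)) hcard,
      lintegral_join_symm e (measurable_density 𝒢 η).ennreal_ofReal]
    refine lintegral_congr fun y => ?_
    set D := schrodinger 𝒢' y with hD
    simp_rw [density_join 𝒢 η e _ y rfl hD rfl hηn]
    simp_rw [ENNReal.ofReal_mul (density_nonneg _ _ _)]
    rw [lintegral_const_mul' _ _ ENNReal.ofReal_ne_top]
    by_cases hpd : D.PosDef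
    · have hBrow : ∀ z : {a // ¬a = v} → ℝ, (crossWeight 𝒢 e *ᵥ z) default = w ⬝ᵥ z :=
        fun z => rfl
      have hinvnn := inv_mulVec_nonneg hpd (fun i j hij => schrodinger_apply_nonpos 𝒢' y hij)
        (b := ηn) (fun i => hη _)
      have hzeta : 0 ≤ w ⬝ᵥ (D⁻¹ *ᵥ ηn) :=
        Finset.sum_nonneg fun i _ => mul_nonneg (𝒢.nonneg _ _) (hinvnn i)
      have hζ : 0 ≤ (η ∘ e ∘ Sum.inl + crossWeight 𝒢 e *ᵥ (D⁻¹ *ᵥ ηn)) default := by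
        rw [Pi.add_apply, hBrow]
        exact add_nonneg (hη _) hzeta
      rw [lintegral_condDensity_of_unique _ _ hζ,
        density_eq_density_zero_mul 𝒢' (ηn + w), ENNReal.ofReal_mul (density_nonneg _ _ _)]
      congr 3
      have hM : (crossWeight 𝒢 e * D⁻¹ * (crossWeight 𝒢 e)ᵀ) default default =
          w ⬝ᵥ (D⁻¹ *ᵥ w) := by
        rw [Matrix.mul_assoc]; rfl
      have hsymm : ηn ⬝ᵥ (D⁻¹ *ᵥ w) = w ⬝ᵥ (D⁻¹ *ᵥ ηn) := by
        have hDt : (D⁻¹)ᵀ = D⁻¹ := by simpa using hpd.inv.isHermitian.eq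
        rw [dotProduct_mulVec, ← mulVec_transpose, hDt, dotProduct_comm]
      have hsum : ∀ f : {a // a = v} → ℝ, (1 : {a // a = v} → ℝ) ⬝ᵥ f = f default := by
        intro f
        simp [dotProduct]
      -- the quadratic form at `ηn + w` expands into the terms produced by the integration
      rw [hM, Pi.add_apply, hBrow, hsum, hsum, hBrow, ← hD, mulVec_add, dotProduct_add,
        add_dotProduct, add_dotProduct, hsymm, dotProduct_add, dotProduct_comm w 1]
      simp only [Function.comp_apply]
      ring
    · rw [density_eq_zero_of_not_posDef hpd, density_eq_zero_of_not_posDef hpd]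
      simp

theorem lintegral_potentialLaw {V : Type*} [Fintype V] [DecidableEq V]
    (𝒢 : WeightedGraph V) (η : V → ℝ) {F : (V → ℝ) → ENNReal} (hF : Measurable F) :
    ∫⁻ β, F β ∂potentialLaw 𝒢 η = ∫⁻ β, ENNReal.ofReal (density 𝒢 η β) * F β :=
  lintegral_withDensity_eq_lintegral_mul _ (measurable_density 𝒢 η).ennreal_ofReal hF

theorem isProbabilityMeasure_potentialLaw {V : Type*} [Fintype V] [DecidableEq V]
    (𝒢 : WeightedGraph V) {η : V → ℝ} (hη : ∀ i, 0 ≤ η i) :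
    IsProbabilityMeasure (potentialLaw 𝒢 η) :=
  ⟨by rw [potentialLaw, withDensity_apply _ MeasurableSet.univ, Measure.restrict_univ,
    lintegral_density 𝒢 hη]⟩

end Normalization

/-! ### The law of the averaged Green function -/

section GreenMean

variable {n : Type*} [Fintype n] [DecidableEq n]

/-- The mean of all entries of the Green matrix. -/
noncomputable def greenMean (𝒢 : WeightedGraph n) (y : n → ℝ) : ℝ :=
  (1 / (Fintype.card n : ℝ) ^ 2) * ((1 : n → ℝ) ⬝ᵥ ((schrodinger 𝒢 y)⁻¹ *ᵥ (1 : n → ℝ)))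

theorem measurable_greenMean (𝒢 : WeightedGraph n) : Measurable (greenMean 𝒢) :=
  (measurable_dotProduct_mulVec (measurable_inv_of_entries (measurable_schrodinger 𝒢))
    measurable_const measurable_const).const_mul _

theorem greenMean_nonneg {𝒢 : WeightedGraph n} {y : n → ℝ}
    (h : (schrodinger 𝒢 y).PosDef) : 0 ≤ greenMean 𝒢 y := by
  have h1 := h.inv.posSemidef.dotProduct_mulVec_nonneg (1 : n → ℝ)
  simp only [star_trivial] at h1
  unfold greenMean
  positivity

/-- The bounded function `t ↦ exp (-t / 2)` on the half-line. -/
noncomputable def expNegHalf : BoundedContinuousFunction NNReal ℝ :=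
  BoundedContinuousFunction.ofNormedAddCommGroup (fun t : NNReal => Real.exp (-(t : ℝ) / 2))
    (by fun_prop) 1 fun t => by
      rw [Real.norm_eq_abs, Real.abs_exp, Real.exp_le_one_iff]
      have : (0 : ℝ) ≤ t := t.2
      linarith

theorem expNegHalf_apply (t : NNReal) : expNegHalf t = Real.exp (-(t : ℝ) / 2) := rfl

/-- The Laplace transform of the averaged Green function, from the normalization of the model with
constant boundary condition `√k / |n|`. -/
theorem integral_expNegHalf_pow [Nonempty n] (𝒢 : WeightedGraph n) (k : ℕ) :
    ∫ t, expNegHalf t ^ k ∂(potentialLaw 𝒢 0).map (fun y => (greenMean 𝒢 y).toNNReal) =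
      Real.exp (-Real.sqrt k) := by
  have hX : Measurable fun y => (greenMean 𝒢 y).toNNReal := (measurable_greenMean 𝒢).real_toNNReal
  have hc : (0 : ℝ) < Fintype.card n := by exact_mod_cast Fintype.card_pos
  set s : ℝ := Real.sqrt k / Fintype.card n with hs
  have hf : Measurable fun t : NNReal => ENNReal.ofReal (expNegHalf t ^ k) :=
    ((expNegHalf.continuous.pow k).measurable).ennreal_ofReal
  have hnorm := lintegral_density 𝒢 (η := fun _ => s) (fun _ => by positivity)
  -- a constant boundary condition tilts the density by an exponential of `greenMean`
  have hpt : ∀ y, ENNReal.ofReal (density 𝒢 0 y) *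
      ENNReal.ofReal (expNegHalf (greenMean 𝒢 y).toNNReal ^ k) =
      ENNReal.ofReal (Real.exp (-Real.sqrt k)) * ENNReal.ofReal (density 𝒢 (fun _ => s) y) := by
    intro y
    rw [← ENNReal.ofReal_mul (density_nonneg _ _ _), ← ENNReal.ofReal_mul (Real.exp_pos _).le]
    congr 1
    by_cases h : (schrodinger 𝒢 y).PosDef
    · rw [density_eq_density_zero_mul 𝒢 (fun _ => s), expNegHalf_apply,
        Real.coe_toNNReal _ (greenMean_nonneg h), ← Real.exp_nat_mul, mul_left_comm,
        ← Real.exp_add]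
      congr 2
      have hsone : (fun _ => s : n → ℝ) = s • (1 : n → ℝ) := by ext; simp
      rw [hsone, mulVec_smul, dotProduct_smul, smul_dotProduct, dotProduct_smul, one_dotProduct_one]
      simp only [smul_eq_mul]
      have hsk : Real.sqrt k ^ 2 = k := Real.sq_sqrt (by positivity)
      unfold greenMean
      rw [hs]
      generalize Real.sqrt k = κ at hsk ⊢
      rw [← hsk]
      field_simp
      ring
    · rw [density_eq_zero_of_not_posDef h, density_eq_zero_of_not_posDef h]
      simp
  have hint := integral_eq_lintegral_of_nonneg_ae
    (μ := (potentialLaw 𝒢 0).map fun y => (greenMean 𝒢 y).toNNReal)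
    (f := fun t => expNegHalf t ^ k)
    (Filter.Eventually.of_forall fun t => pow_nonneg (Real.exp_pos _).le k)
    (expNegHalf.continuous.pow k).aestronglyMeasurable
  rw [hint, lintegral_map hf hX, lintegral_potentialLaw _ _
    (F := fun y => ENNReal.ofReal (expNegHalf (greenMean 𝒢 y).toNNReal ^ k)) (hf.comp hX),
    lintegral_congr hpt,
    lintegral_const_mul' _ _ ENNReal.ofReal_ne_top, hnorm, mul_one,
    ENNReal.toReal_ofReal (Real.exp_pos _).le]

/-- The law of the averaged Green function of the model without boundary condition does not depend
on the graph. -/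
theorem map_greenMean_eq {n' : Type*} [Fintype n'] [DecidableEq n'] [Nonempty n] [Nonempty n']
    (𝒢 : WeightedGraph n) (𝒢' : WeightedGraph n') :
    (potentialLaw 𝒢 0).map (fun y => (greenMean 𝒢 y).toNNReal) =
      (potentialLaw 𝒢' 0).map (fun y => (greenMean 𝒢' y).toNNReal) := by
  have := isProbabilityMeasure_potentialLaw 𝒢 (η := 0) (fun _ => le_rfl)
  have := isProbabilityMeasure_potentialLaw 𝒢' (η := 0) (fun _ => le_rfl)
  refine ext_of_moments_eq expNegHalf (fun s t hst => ?_) fun k => ?_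
  · rw [expNegHalf_apply, expNegHalf_apply, Real.exp_eq_exp] at hst
    exact NNReal.coe_injective (by linarith)
  · rw [integral_expNegHalf_pow, integral_expNegHalf_pow]

theorem lintegral_density_mul_comp_greenMean_eq_lintegral_map (𝒢 : WeightedGraph n)
    {Φ : ℝ → ENNReal} (hΦ : Measurable Φ) :
    ∫⁻ y, ENNReal.ofReal (density 𝒢 0 y) * Φ (greenMean 𝒢 y) =
      ∫⁻ t : NNReal, Φ t ∂(potentialLaw 𝒢 0).map (fun y => (greenMean 𝒢 y).toNNReal) := by
  have hX := (measurable_greenMean 𝒢).real_toNNReal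
  have hΦ' : Measurable fun t : NNReal => Φ t := hΦ.comp measurable_coe_nnreal_real
  rw [lintegral_map hΦ' hX, lintegral_potentialLaw _ _
    (F := fun y => Φ (greenMean 𝒢 y).toNNReal) (hΦ'.comp hX)]
  refine lintegral_congr fun y => ?_
  by_cases h : (schrodinger 𝒢 y).PosDef
  · rw [Real.coe_toNNReal _ (greenMean_nonneg h)]
  · rw [density_eq_zero_of_not_posDef h]
    simp

theorem lintegral_density_mul_comp_greenMean {n' : Type*} [Fintype n'] [DecidableEq n']
    [Nonempty n] [Nonempty n'] (𝒢 : WeightedGraph n) (𝒢' : WeightedGraph n')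
    {Φ : ℝ → ENNReal} (hΦ : Measurable Φ) :
    ∫⁻ y, ENNReal.ofReal (density 𝒢 0 y) * Φ (greenMean 𝒢 y) =
      ∫⁻ y, ENNReal.ofReal (density 𝒢' 0 y) * Φ (greenMean 𝒢' y) := by
  rw [lintegral_density_mul_comp_greenMean_eq_lintegral_map 𝒢 hΦ, map_greenMean_eq 𝒢 𝒢',
    ← lintegral_density_mul_comp_greenMean_eq_lintegral_map 𝒢' hΦ]

end GreenMean

/-! ### Merging indistinguishable vertices: the law of the potential -/

section Law

/-- When the eliminated vertices are indistinguishable from the remaining ones, the conditional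
density depends on their potential only through `greenMean`, and it involves only the total weights
`w` and the total boundary value `h`. -/
theorem density_join_of_const {V m n : Type*} [Fintype V] [DecidableEq V] [Fintype m]
    [DecidableEq m] [Fintype n] [DecidableEq n] [Nonempty n] (𝒢 : WeightedGraph V) (η : V → ℝ)
    (e : m ⊕ n ≃ V) (x : m → ℝ) (y : n → ℝ) {w : m → ℝ} {h : ℝ}
    (hw : ∀ i j, 𝒢.weight (e (Sum.inl i)) (e (Sum.inr j)) = w i / Fintype.card n)
    (hη : ∀ j, η (e (Sum.inr j)) = h / Fintype.card n) {g : ℝ}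
    (hg : g = greenMean (𝒢.comap (e ∘ Sum.inr)) y) :
    density 𝒢 η (join e x y) = density (𝒢.comap (e ∘ Sum.inr)) 0 y *
      condDensity (𝒢.comap (e ∘ Sum.inl)) (g • vecMulVec w w) (η ∘ e ∘ Sum.inl + (g * h) • w)
        ((1 : m → ℝ) ⬝ᵥ w - (1 / 2) * (h ^ 2 * g) + (1 : m → ℝ) ⬝ᵥ (η ∘ e ∘ Sum.inl) + h) x := by
  have hN : (Fintype.card n : ℝ) ≠ 0 := by exact_mod_cast Fintype.card_ne_zero
  set D := schrodinger (𝒢.comap (e ∘ Sum.inr)) y with hD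
  set ηn : n → ℝ := η ∘ e ∘ Sum.inr with hηn
  have hn : ηn = (h / Fintype.card n) • (1 : n → ℝ) := by
    ext j; simp [hηn, hη]
  have hB : ∀ i, crossWeight 𝒢 e i = (w i / Fintype.card n) • (1 : n → ℝ) := by
    intro i; ext j; simp [crossWeight, hw]
  set a := (1 : n → ℝ) ⬝ᵥ (D⁻¹ *ᵥ (1 : n → ℝ)) with ha
  have hga : g = a / (Fintype.card n : ℝ) ^ 2 := by
    rw [hg, greenMean, ← hD, ← ha]; ring
  have hBmul : ∀ z : n → ℝ,
      crossWeight 𝒢 e *ᵥ z = (((1 : n → ℝ) ⬝ᵥ z) / Fintype.card n) • w := by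
    intro z
    ext i
    change crossWeight 𝒢 e i ⬝ᵥ z = _
    rw [hB, smul_dotProduct]
    simp only [smul_eq_mul, Pi.smul_apply]
    ring
  have h1 : crossWeight 𝒢 e * D⁻¹ * (crossWeight 𝒢 e)ᵀ = g • vecMulVec w w := by
    ext i j
    rw [Matrix.mul_assoc]
    change crossWeight 𝒢 e i ⬝ᵥ (D⁻¹ *ᵥ crossWeight 𝒢 e j) = _
    rw [hB, hB, mulVec_smul, dotProduct_smul, smul_dotProduct, ← ha, hga]
    simp only [smul_eq_mul, Matrix.smul_apply, vecMulVec_apply]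
    field_simp
  have h2 : crossWeight 𝒢 e *ᵥ (D⁻¹ *ᵥ ηn) = (g * h) • w := by
    rw [hBmul, hn, mulVec_smul, dotProduct_smul, ← ha, hga]
    congr 1
    simp only [smul_eq_mul]
    field_simp
  have h3 : crossWeight 𝒢 e *ᵥ (1 : n → ℝ) = w := by
    rw [hBmul, one_dotProduct_one, div_self hN, one_smul]
  have h4 : ηn ⬝ᵥ (D⁻¹ *ᵥ ηn) = h ^ 2 * g := by
    rw [hn, mulVec_smul, dotProduct_smul, smul_dotProduct, ← ha, hga]
    simp only [smul_eq_mul]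
    field_simp
  have h5 : (1 : n → ℝ) ⬝ᵥ ηn = h := by
    rw [hn, dotProduct_smul, one_dotProduct_one]
    simp only [smul_eq_mul]
    field_simp
  rw [density_join 𝒢 η e x y rfl hD rfl hηn, h1, h2, h3, h4, h5]

/-- In the one-vertex model the potential is recovered from the Green function. -/
theorem one_div_two_mul_greenMean_unit {𝒢 : WeightedGraph Unit} {b : Unit → ℝ}
    (h : (schrodinger 𝒢 b).PosDef) : (fun _ => 1 / (2 * greenMean 𝒢 b)) = b := by
  have hH : schrodinger 𝒢 b = diagonal fun _ => 2 * b () := by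
    ext i j
    simp [schrodinger, 𝒢.loopless]
  have hpos : 0 < 2 * b () := by
    rw [hH, posDef_diagonal_iff] at h
    exact h ()
  have hinv : (diagonal fun _ : Unit => 2 * b ())⁻¹ = diagonal fun _ => (2 * b ())⁻¹ :=
    inv_eq_right_inv (by
      rw [diagonal_mul_diagonal, ← diagonal_one]
      congr 1
      ext
      exact mul_inv_cancel₀ hpos.ne')
  ext ⟨⟩
  unfold greenMean
  rw [hH, hinv]
  simp only [dotProduct, mulVec_diagonal, Finset.univ_unique, Finset.sum_singleton, Pi.one_apply,
    Fintype.card_unit]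
  have : b () ≠ 0 := by intro h0; simp [h0] at hpos
  field_simp
  simp

variable {V : Type*} [DecidableEq V]

/-- The splitting of the vertex set into the complement of `U` and `U`. -/
def complSplit (U : Finset V) : {k : V // k ∉ U} ⊕ {i : V // i ∈ U} ≃ V :=
  (Equiv.sumComm _ _).trans (Equiv.sumCompl fun a => a ∈ U)

/-- The splitting of the reduced vertex set into the complement of `U` and the merged vertex. -/
def reducedSplit (U : Finset V) : {k : V // k ∉ U} ⊕ Unit ≃ Reduced U :=
  (Equiv.optionEquivSumPUnit _).symm

theorem blockAverage_join (𝒢 : WeightedGraph V) (U : Finset V) (x : {k : V // k ∉ U} → ℝ)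
    (y : {i : V // i ∈ U} → ℝ) :
    blockAverage 𝒢 U (join (complSplit U) x y) =
      greenMean (𝒢.comap (complSplit U ∘ Sum.inr)) y := by
  have hblock : block 𝒢 U (join (complSplit U) x y) =
      schrodinger (𝒢.comap (complSplit U ∘ Sum.inr)) y := by
    ext i j
    have := congrFun (congrFun (schrodinger_join 𝒢 (complSplit U) x y) (Sum.inr i)) (Sum.inr j)
    exact this
  unfold blockAverage greenMean
  rw [hblock, Fintype.card_coe]
  simp [dotProduct, mulVec]

theorem coarsePotential_join (𝒢 : WeightedGraph V) (U : Finset V) (x : {k : V // k ∉ U} → ℝ)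
    (y : {i : V // i ∈ U} → ℝ) :
    coarsePotential 𝒢 U (join (complSplit U) x y) = join (reducedSplit U) x
      fun _ => 1 / (2 * greenMean (𝒢.comap (complSplit U ∘ Sum.inr)) y) := by
  ext (_ | k)
  · change 1 / (2 * blockAverage 𝒢 U (join (complSplit U) x y)) = _
    rw [blockAverage_join]
    rfl
  · change join (complSplit U) x y k = x k
    have : (k : V) = complSplit U (Sum.inl k) := rfl
    rw [this, join, Equiv.symm_apply_apply]
    rfl

theorem measurable_blockAverage (𝒢 : WeightedGraph V) (U : Finset V) :
    Measurable (blockAverage 𝒢 U) := by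
  have hblock : ∀ i j, Measurable fun β => (block 𝒢 U β)⁻¹ i j :=
    measurable_inv_of_entries (M := fun β => block 𝒢 U β)
      fun i j => measurable_schrodinger 𝒢 (i : V) (j : V)
  unfold blockAverage
  exact (Finset.measurable_fun_sum _ fun i _ =>
    Finset.measurable_fun_sum _ fun j _ => hblock i j).const_mul _

theorem measurable_coarsePotential (𝒢 : WeightedGraph V) (U : Finset V) :
    Measurable (coarsePotential 𝒢 U) := by
  refine measurable_pi_lambda _ fun k => ?_
  rcases k with _ | k
  · exact ((measurable_blockAverage 𝒢 U).const_mul 2).const_div 1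
  · exact measurable_pi_apply (k : V)

/-- The coarse-grained potential has the law of the potential of the reduced model: given `β` off
`U`, both densities have the same dependence on the averaged Green function of the eliminated
vertices, and the law of the latter is universal. -/
theorem map_coarsePotential [Fintype V] (𝒢 : WeightedGraph V) (η : V → ℝ) {U : Finset V}
    (hU : U.Nonempty) (hind : Indistinguishable 𝒢 η U) :
    (potentialLaw 𝒢 η).map (coarsePotential 𝒢 U) =
      potentialLaw (reducedGraph 𝒢 U) (reducedBoundary η U) := by
  obtain ⟨u, hu⟩ := hU
  have : Nonempty {i : V // i ∈ U} := ⟨⟨u, hu⟩⟩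
  have hcard : (Fintype.card {i : V // i ∈ U} : ℝ) ≠ 0 := by exact_mod_cast Fintype.card_ne_zero
  set w : {k : V // k ∉ U} → ℝ := fun k => ∑ i ∈ U, 𝒢.weight k i with hw
  set h : ℝ := ∑ i ∈ U, η i with hh
  set 𝒢U := 𝒢.comap (complSplit U ∘ Sum.inr)
  set 𝒢1 := (reducedGraph 𝒢 U).comap (reducedSplit U ∘ Sum.inr)
  set 𝒢C := 𝒢.comap (complSplit U ∘ Sum.inl)
  set ηC : {k : V // k ∉ U} → ℝ := η ∘ complSplit U ∘ Sum.inl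
  -- the two factorizations have the same conditional density `K`
  set K : ({k : V // k ∉ U} → ℝ) → ℝ → ℝ := fun x g =>
    condDensity 𝒢C (g • vecMulVec w w) (ηC + (g * h) • w)
      ((1 : {k : V // k ∉ U} → ℝ) ⬝ᵥ w - (1 / 2) * (h ^ 2 * g)
        + (1 : {k : V // k ∉ U} → ℝ) ⬝ᵥ ηC + h) x
  have hfull : ∀ x y, density 𝒢 η (join (complSplit U) x y) =
      density 𝒢U 0 y * K x (greenMean 𝒢U y) := by
    intro x y
    refine density_join_of_const 𝒢 η (complSplit U) x y (w := w) (h := h) (fun i j => ?_)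
      (fun j => ?_) rfl
    · rw [eq_div_iff hcard, hw, Fintype.card_coe]
      change 𝒢.weight i j * U.card = ∑ l ∈ U, 𝒢.weight i l
      rw [Finset.sum_congr rfl fun l hl => hind.1 l hl j j.2 i i.2]
      simp [mul_comm]
    · rw [eq_div_iff hcard, hh, Fintype.card_coe]
      change η j * U.card = ∑ l ∈ U, η l
      rw [Finset.sum_congr rfl fun l hl => hind.2 l hl j j.2]
      simp [mul_comm]
  -- a single eliminated vertex satisfies the constancy hypotheses trivially
  have hred : ∀ x b, density (reducedGraph 𝒢 U) (reducedBoundary η U)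
      (join (reducedSplit U) x b) = density 𝒢1 0 b * K x (greenMean 𝒢1 b) := by
    intro x b
    refine density_join_of_const (reducedGraph 𝒢 U) (reducedBoundary η U) (reducedSplit U) x b
      (w := w) (h := h) (fun i j => ?_) (fun j => ?_) rfl
    · rw [Fintype.card_unit, Nat.cast_one, div_one]; rfl
    · rw [Fintype.card_unit, Nat.cast_one, div_one]; rfl
  have hKm : ∀ x, Measurable (K x) := by
    intro x
    refine measurable_condDensity 𝒢C (fun i j => ?_) ?_ ?_ measurable_const
    · simp only [Matrix.smul_apply, smul_eq_mul]
      fun_prop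
    · fun_prop
    · fun_prop
  refine Measure.ext_of_lintegral _ fun F hF => ?_
  have hFc := hF.comp (measurable_coarsePotential 𝒢 U)
  rw [lintegral_map hF (measurable_coarsePotential 𝒢 U),
    lintegral_potentialLaw _ _ (F := fun β => F (coarsePotential 𝒢 U β)) hFc,
    lintegral_potentialLaw _ _ hF,
    lintegral_join (complSplit U) (F := fun β =>
      ENNReal.ofReal (density 𝒢 η β) * F (coarsePotential 𝒢 U β))
      ((measurable_density 𝒢 η).ennreal_ofReal.mul hFc),
    lintegral_join (reducedSplit U) (F := fun β =>
      ENNReal.ofReal (density (reducedGraph 𝒢 U) (reducedBoundary η U) β) * F β)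
      ((measurable_density _ _).ennreal_ofReal.mul hF)]
  refine lintegral_congr fun x => ?_
  set Φ : ℝ → ENNReal := fun g =>
    ENNReal.ofReal (K x g) * F (join (reducedSplit U) x fun _ => 1 / (2 * g)) with hΦ
  have hΦm : Measurable Φ := by
    refine (hKm x).ennreal_ofReal.mul (hF.comp ?_)
    refine (measurable_join (reducedSplit U)).comp (measurable_const.prodMk ?_)
    fun_prop
  have hL : ∀ y, ENNReal.ofReal (density 𝒢 η (join (complSplit U) x y)) *
      F (coarsePotential 𝒢 U (join (complSplit U) x y)) =
      ENNReal.ofReal (density 𝒢U 0 y) * Φ (greenMean 𝒢U y) := by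
    intro y
    rw [hfull, coarsePotential_join, ENNReal.ofReal_mul (density_nonneg _ _ _), mul_assoc]
  have hR : ∀ b, ENNReal.ofReal (density (reducedGraph 𝒢 U) (reducedBoundary η U)
      (join (reducedSplit U) x b)) * F (join (reducedSplit U) x b) =
      ENNReal.ofReal (density 𝒢1 0 b) * Φ (greenMean 𝒢1 b) := by
    intro b
    rw [hred, ENNReal.ofReal_mul (density_nonneg _ _ _), mul_assoc]
    by_cases hb : (schrodinger 𝒢1 b).PosDef
    · simp only [hΦ]
      rw [one_div_two_mul_greenMean_unit hb]
    · rw [density_eq_zero_of_not_posDef hb]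
      simp
  exact (lintegral_congr hL).trans
    ((lintegral_density_mul_comp_greenMean 𝒢U 𝒢1 hΦm).trans (lintegral_congr hR).symm)

end Law

/-! ### Merging indistinguishable vertices: the Green matrix -/

section GreenMatrix

variable {V : Type*} [DecidableEq V]

theorem blockAverage_pos {𝒢 : WeightedGraph V} {U : Finset V} (hU : U.Nonempty) {β : V → ℝ}
    (h : (block 𝒢 U β).PosDef) : 0 < blockAverage 𝒢 U β := by
  obtain ⟨u, hu⟩ := hU
  have : Nonempty {i : V // i ∈ U} := ⟨⟨u, hu⟩⟩
  have h1 := h.inv.dotProduct_mulVec_pos (x := (1 : {i : V // i ∈ U} → ℝ)) one_ne_zero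
  have hc : 0 < U.card := Finset.card_pos.2 ⟨u, hu⟩
  simp only [star_trivial, dotProduct, mulVec, Pi.one_apply, one_mul, mul_one] at h1
  unfold blockAverage
  positivity

theorem posDef_block {𝒢 : WeightedGraph V} {U : Finset V} {β : V → ℝ}
    (h : (schrodinger 𝒢 β).PosDef) : (block 𝒢 U β).PosDef :=
  h.submatrix Subtype.val_injective

variable [Fintype V]

/-- The averaging matrix: the row of a vertex off `U` is a unit vector, that of the merged vertex
is the uniform distribution on `U`. -/
noncomputable def averaging (U : Finset V) : Matrix (Reduced U) V ℝ :=
  Matrix.of fun k j =>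
    match k with
    | some k => if (k : V) = j then 1 else 0
    | none => if j ∈ U then 1 / (U.card : ℝ) else 0

theorem coarseGrain_eq (U : Finset V) (G : Matrix V V ℝ) :
    coarseGrain U G = averaging U * G * (averaging U)ᵀ := by
  ext (_ | k) (_ | l)
  · simp only [coarseGrain, averaging, Matrix.mul_apply, of_apply, transpose_apply, ite_mul,
      mul_ite, mul_zero, zero_mul, Finset.sum_ite_mem, Finset.univ_inter, Finset.mul_sum,
      Finset.sum_mul]
    rw [Finset.sum_comm]
    refine Finset.sum_congr rfl fun i _ => Finset.sum_congr rfl fun j _ => ?_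
    ring
  · simp [coarseGrain, averaging, Matrix.mul_apply, Finset.mul_sum]
  · simp [coarseGrain, averaging, Matrix.mul_apply, Finset.sum_mul, Finset.mul_sum, mul_comm]
  · simp [coarseGrain, averaging, Matrix.mul_apply]

/-- A right inverse of the averaging matrix, adapted to the potential `β`: the column of the merged
vertex is proportional to `(H_{U,U})⁻¹ 1`. -/
noncomputable def averagingSection (𝒢 : WeightedGraph V) (U : Finset V) (β : V → ℝ) :
    Matrix V (Reduced U) ℝ :=
  Matrix.of fun i k =>
    match k with
    | some k => if i = k then 1 else 0
    | none => if h : i ∈ U then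
        (∑ j, (block 𝒢 U β)⁻¹ ⟨i, h⟩ j) / (U.card * blockAverage 𝒢 U β) else 0

theorem averaging_mul_averagingSection {𝒢 : WeightedGraph V} {U : Finset V} (hU : U.Nonempty)
    {β : V → ℝ} (h : (block 𝒢 U β).PosDef) :
    averaging U * averagingSection 𝒢 U β = 1 := by
  have ha := (blockAverage_pos hU h).ne'
  have hc : (U.card : ℝ) ≠ 0 := by exact_mod_cast (Finset.card_pos.2 hU).ne'
  ext (_ | k) (_ | l)
  · simp only [averaging, averagingSection, Matrix.mul_apply, of_apply, ite_mul, zero_mul,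
      Finset.sum_ite_mem, Finset.univ_inter, one_apply_eq]
    rw [← Finset.sum_coe_sort U]
    simp only [Finset.coe_mem, dite_true, Subtype.coe_eta]
    rw [← Finset.mul_sum, ← Finset.sum_div]
    have : ∑ i : {i : V // i ∈ U}, ∑ j, (block 𝒢 U β)⁻¹ i j =
        (U.card : ℝ) ^ 2 * blockAverage 𝒢 U β := by
      unfold blockAverage; field_simp
    rw [this]
    field_simp
  · simp [averaging, averagingSection, Matrix.mul_apply, l.2]
  · simp only [averaging, averagingSection, Matrix.mul_apply, of_apply, ite_mul, one_mul, zero_mul,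
      Finset.sum_ite_eq, Finset.mem_univ, if_true, dif_neg k.2, ne_eq, reduceCtorEq,
      not_false_eq_true, one_apply_ne]
  · simp [averaging, averagingSection, Matrix.mul_apply, one_apply, Subtype.ext_iff]

/-- The intertwining relation `H X = Pᵀ H'` between the Schrödinger matrix and the reduced one,
where `P` is the averaging matrix and `X` its section. -/
theorem schrodinger_mul_averagingSection {𝒢 : WeightedGraph V} {η : V → ℝ} {U : Finset V}
    (hU : U.Nonempty) (hind : Indistinguishable 𝒢 η U) {β : V → ℝ}
    (h : (block 𝒢 U β).PosDef) :
    schrodinger 𝒢 β * averagingSection 𝒢 U β =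
      (averaging U)ᵀ * schrodinger (reducedGraph 𝒢 U) (coarsePotential 𝒢 U β) := by
  have ha := (blockAverage_pos hU h).ne'
  have hc : (U.card : ℝ) ≠ 0 := by exact_mod_cast (Finset.card_pos.2 hU).ne'
  have hsum : ∀ i ∉ U, ∀ u ∈ U, ∑ l ∈ U, 𝒢.weight i l = U.card * 𝒢.weight i u := by
    intro i hi u hu
    rw [Finset.sum_congr rfl fun l hl => hind.1 l hl u hu i hi]
    simp
  have hPt : ∀ (k : Reduced U → ℝ) (i : V), ((averaging U)ᵀ *ᵥ k) i =
      if hi : i ∈ U then k none / U.card else k (some ⟨i, hi⟩) := by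
    intro k i
    simp only [mulVec, dotProduct, transpose_apply, averaging, of_apply, Fintype.sum_option]
    by_cases hi : i ∈ U
    · rw [dif_pos hi, if_pos hi, Finset.sum_eq_zero, add_zero]
      · ring
      · intro l _
        rw [if_neg (fun hl => l.2 (by rw [hl]; exact hi)), zero_mul]
    · rw [dif_neg hi, if_neg hi, Finset.sum_eq_single ⟨i, hi⟩]
      · simp
      · intro l _ hl
        rw [if_neg (fun h' => hl (Subtype.ext h')), zero_mul]
      · simp
  ext i k
  have hR : ((averaging U)ᵀ * schrodinger (reducedGraph 𝒢 U) (coarsePotential 𝒢 U β)) i k =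
      ((averaging U)ᵀ *ᵥ fun l => schrodinger (reducedGraph 𝒢 U) (coarsePotential 𝒢 U β) l k) i :=
    rfl
  rw [hR, hPt]
  rcases k with _ | k
  · have hL : (schrodinger 𝒢 β * averagingSection 𝒢 U β) i none =
        (∑ l : {l : V // l ∈ U}, schrodinger 𝒢 β i l * ∑ j, (block 𝒢 U β)⁻¹ l j) /
          (U.card * blockAverage 𝒢 U β) := by
      simp only [Matrix.mul_apply, averagingSection, of_apply]
      rw [← Finset.sum_subset (Finset.subset_univ U), ← Finset.sum_coe_sort U, Finset.sum_div]
      · refine Finset.sum_congr rfl fun l _ => ?_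
        rw [dif_pos l.2, mul_div_assoc]
      · intro l _ hl
        rw [dif_neg hl, mul_zero]
    rw [hL]
    by_cases hi : i ∈ U
    · rw [dif_pos hi]
      have hone : ∑ l : {l : V // l ∈ U}, schrodinger 𝒢 β i l * ∑ j, (block 𝒢 U β)⁻¹ l j = 1 := by
        have h1 : (block 𝒢 U β * (block 𝒢 U β)⁻¹) *ᵥ 1 = (1 : {l : V // l ∈ U} → ℝ) := by
          rw [mul_nonsing_inv _ ((isUnit_iff_isUnit_det _).1 h.isUnit), one_mulVec]
        rw [← mulVec_mulVec] at h1
        have h2 := congrFun h1 ⟨i, hi⟩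
        simpa [mulVec, dotProduct, block] using h2
      rw [hone]
      simp only [schrodinger, reducedGraph, reducedWeight, coarsePotential, Matrix.sub_apply,
        diagonal_apply_eq, of_apply]
      field_simp
      ring
    · rw [dif_neg hi]
      obtain ⟨u, hu⟩ := hU
      have hw : ∀ l : {l : V // l ∈ U}, schrodinger 𝒢 β i l = -𝒢.weight i u := by
        intro l
        have hne : i ≠ l := fun h' => hi (h' ▸ l.2)
        simp [schrodinger, hne, hind.1 l l.2 u hu i hi]
      simp_rw [hw]
      rw [← Finset.mul_sum]
      have : ∑ i : {i : V // i ∈ U}, ∑ j, (block 𝒢 U β)⁻¹ i j =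
          (U.card : ℝ) ^ 2 * blockAverage 𝒢 U β := by
        unfold blockAverage; field_simp
      rw [this]
      simp only [schrodinger, reducedGraph, reducedWeight, Matrix.sub_apply, of_apply, ne_eq,
        reduceCtorEq, not_false_eq_true, diagonal_apply_ne, zero_sub]
      rw [hsum i hi u hu]
      field_simp
  · have hL : (schrodinger 𝒢 β * averagingSection 𝒢 U β) i (some k) = schrodinger 𝒢 β i k := by
      simp [Matrix.mul_apply, averagingSection]
    rw [hL]
    by_cases hi : i ∈ U
    · rw [dif_pos hi]
      have hne : i ≠ k := fun h' => k.2 (h' ▸ hi)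
      simp only [schrodinger, reducedGraph, reducedWeight, Matrix.sub_apply, of_apply, ne_eq,
        reduceCtorEq, not_false_eq_true, diagonal_apply_ne, zero_sub, hne]
      rw [hsum k k.2 i hi, 𝒢.symm i k]
      field_simp
    · rw [dif_neg hi]
      simp only [schrodinger, reducedGraph, reducedWeight, coarsePotential, Matrix.sub_apply,
        of_apply, diagonal_apply, Option.some.injEq, Subtype.ext_iff]

theorem coarseGrain_green_mul {𝒢 : WeightedGraph V} {η : V → ℝ} {U : Finset V}
    (hU : U.Nonempty) (hind : Indistinguishable 𝒢 η U) {β : V → ℝ}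
    (h : (schrodinger 𝒢 β).PosDef) :
    coarseGrain U (green 𝒢 β) *
      schrodinger (reducedGraph 𝒢 U) (coarsePotential 𝒢 U β) = 1 := by
  have hb := posDef_block (U := U) h
  rw [coarseGrain_eq, Matrix.mul_assoc, ← schrodinger_mul_averagingSection hU hind hb,
    Matrix.mul_assoc, ← Matrix.mul_assoc (green 𝒢 β), green,
    nonsing_inv_mul _ ((isUnit_iff_isUnit_det _).1 h.isUnit), Matrix.one_mul,
    averaging_mul_averagingSection hU hb]

theorem posDef_coarseGrain_green {𝒢 : WeightedGraph V} {U : Finset V} (hU : U.Nonempty)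
    {β : V → ℝ} (h : (schrodinger 𝒢 β).PosDef) : (coarseGrain U (green 𝒢 β)).PosDef := by
  have hinj : Function.Injective (averaging U).vecMul := by
    intro a b hab
    have := congrArg (fun z => z ᵥ* averagingSection 𝒢 U β) hab
    simpa only [vecMul_vecMul, averaging_mul_averagingSection hU (posDef_block h), vecMul_one]
      using this
  rw [coarseGrain_eq, ← conjTranspose_eq_transpose_of_trivial]
  exact h.inv.mul_mul_conjTranspose_same hinj

end GreenMatrix

theorem ae_posDef_schrodinger {V : Type*} [Fintype V] [DecidableEq V] (𝒢 : WeightedGraph V)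
    (η : V → ℝ) : ∀ᵐ β ∂potentialLaw 𝒢 η, (schrodinger 𝒢 β).PosDef := by
  rw [potentialLaw, ae_withDensity_iff (measurable_density 𝒢 η).ennreal_ofReal]
  refine Filter.Eventually.of_forall fun β hβ => ?_
  by_contra h
  exact hβ (by rw [density_eq_zero_of_not_posDef h, ENNReal.ofReal_zero])

end HTwoTwo

theorem mainTheorem4 {V : Type*} [Fintype V] [DecidableEq V]
    (𝒢 : HTwoTwo.WeightedGraph V) (η : V → ℝ) (hη : ∀ i, 0 ≤ η i)
    (U : Finset V) (hU : U.Nonempty) (hind : HTwoTwo.Indistinguishable 𝒢 η U)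
    {Ω : Type*} [MeasurableSpace Ω] (P : Measure Ω) (β : Ω → V → ℝ)
    (hβ : HasLaw β (HTwoTwo.potentialLaw 𝒢 η) P) :
    -- the averaged Green matrix has the law of the Green matrix of the reduced model
    HasLaw (fun ω k l => HTwoTwo.coarseGrain U (HTwoTwo.green 𝒢 (β ω)) k l)
      (HTwoTwo.greenLaw (HTwoTwo.reducedGraph 𝒢 U) (HTwoTwo.reducedBoundary η U)) P ∧
    -- the potential `β'` has the law of the potential of the reduced model
    HasLaw (fun ω => HTwoTwo.coarsePotential 𝒢 U (β ω))
      (HTwoTwo.potentialLaw (HTwoTwo.reducedGraph 𝒢 U) (HTwoTwo.reducedBoundary η U)) P ∧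
    -- almost surely, all inverses below are genuine and `G'⁻¹ = H'_{β'}`
    ∀ᵐ ω ∂P,
      (HTwoTwo.schrodinger 𝒢 (β ω)).PosDef ∧
      (HTwoTwo.block 𝒢 U (β ω)).PosDef ∧
      (HTwoTwo.coarseGrain U (HTwoTwo.green 𝒢 (β ω))).PosDef ∧
      (HTwoTwo.coarseGrain U (HTwoTwo.green 𝒢 (β ω)))⁻¹ =
        HTwoTwo.schrodinger (HTwoTwo.reducedGraph 𝒢 U) (HTwoTwo.coarsePotential 𝒢 U (β ω)) ∧
      0 < HTwoTwo.coarsePotential 𝒢 U (β ω) none ∧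
      1 / (2 * HTwoTwo.coarsePotential 𝒢 U (β ω) none) =
        (1 / (U.card : ℝ) ^ 2) * ∑ i, ∑ j, (HTwoTwo.block 𝒢 U (β ω))⁻¹ i j := by
  have hae : ∀ᵐ ω ∂P, (HTwoTwo.schrodinger 𝒢 (β ω)).PosDef := by
    have h := HTwoTwo.ae_posDef_schrodinger 𝒢 η
    rw [← hβ.map_eq] at h
    exact ae_of_ae_map hβ.aemeasurable h
  have hpot : HasLaw (fun ω => HTwoTwo.coarsePotential 𝒢 U (β ω))
      (HTwoTwo.potentialLaw (HTwoTwo.reducedGraph 𝒢 U) (HTwoTwo.reducedBoundary η U)) P :=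
    HasLaw.fun_comp (Y := HTwoTwo.coarsePotential 𝒢 U)
      ⟨(HTwoTwo.measurable_coarsePotential 𝒢 U).aemeasurable,
        HTwoTwo.map_coarsePotential 𝒢 η hU hind⟩ hβ
  refine ⟨?_, hpot, ?_⟩
  · have hgm : Measurable fun (β' : HTwoTwo.Reduced U → ℝ) k l =>
        HTwoTwo.green (HTwoTwo.reducedGraph 𝒢 U) β' k l :=
      measurable_pi_lambda _ fun k => measurable_pi_lambda _ fun l =>
        HTwoTwo.measurable_inv_of_entries (HTwoTwo.measurable_schrodinger _) k l
    have hgreen : HasLaw (fun ω k l => HTwoTwo.green (HTwoTwo.reducedGraph 𝒢 U)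
        (HTwoTwo.coarsePotential 𝒢 U (β ω)) k l)
        (HTwoTwo.greenLaw (HTwoTwo.reducedGraph 𝒢 U) (HTwoTwo.reducedBoundary η U)) P :=
      HasLaw.fun_comp (Y := fun β' k l => HTwoTwo.green (HTwoTwo.reducedGraph 𝒢 U) β' k l)
        ⟨hgm.aemeasurable, rfl⟩ hpot
    refine hgreen.congr ?_
    filter_upwards [hae] with ω hω
    have hinv : (HTwoTwo.schrodinger (HTwoTwo.reducedGraph 𝒢 U)
        (HTwoTwo.coarsePotential 𝒢 U (β ω)))⁻¹ = HTwoTwo.coarseGrain U (HTwoTwo.green 𝒢 (β ω)) :=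
      inv_eq_left_inv (HTwoTwo.coarseGrain_green_mul hU hind hω)
    ext k l
    exact congrFun (congrFun hinv.symm k) l
  · filter_upwards [hae] with ω hω
    have hb := HTwoTwo.posDef_block (U := U) hω
    have ha := HTwoTwo.blockAverage_pos hU hb
    refine ⟨hω, hb, HTwoTwo.posDef_coarseGrain_green hU hω,
      inv_eq_right_inv (HTwoTwo.coarseGrain_green_mul hU hind hω), ?_, ?_⟩
    · change 0 < 1 / (2 * HTwoTwo.blockAverage 𝒢 U (β ω))
      positivity
    · change 1 / (2 * (1 / (2 * HTwoTwo.blockAverage 𝒢 U (β ω)))) =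
        HTwoTwo.blockAverage 𝒢 U (β ω)
      field_simp
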